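/- Consider $n$ agents, $m$ projects and a total budget of $1$. Agent $i$ has a rational demand $\mathsf d^i_j\in[0,1]$ for each project $j$, where $\sum_{j=1}^m \mathsf d^i_j\le 1$ for every $i$. A vector $\mathbf x\in[0,1]^m$ is budget-feasible if $\sum_{j=1}^m x_j\le 1$, and it satisfies agent $i$ with threshold $\tau$ if $x_j\ge \mathsf d^i_j$ for at least $\tau$ projects $j$. The problem all-agents-sat$(m-1)$ asks, given $n$, $m$ and the demands (each written as a fraction in lowest terms, with numerator and denominator in binary), whether there is a budget-feasible $\mathbf x$ that satisfies all agents with threshold $\tau=m-1$. **Theorem.** There is a pseudopolynomial time algorithm that decides all-agents-sat$(m-1)$ on the instances in which every agent has total demand exactly $1$, i.e. $\sum_{j=1}^m \mathsf d^i_j=1$ for all $i$. That is, there is a single program for a random access machine with logarithmic cost that halts with the correct answer on all such instances, and whose running time is bounded by a fixed polynomial in the binary length of the input and the largest integer occurring in it. -/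

import Mathlib

/-! ## Machine model

A random access machine with logarithmic cost. The memory consists of registers and of arrays, all
holding natural numbers of unbounded size; programs are structured programs (sequencing, branching,
loops), which mention only finitely many registers and arrays. Each elementary operation is charged
one unit plus the bit lengths of the numbers (operands, indices and results) that it handles, so
that running time agrees with running time on a multitape Turing machine up to a polynomial. -/

namespace RAM

/-- A memory content: the value of each register and of each cell of each array. -/
structure State where
  var : ℕ → ℕ
  arr : ℕ → ℕ → ℕ

/-- Arithmetic terms. -/
inductive Term where
  | lit (n : ℕ)
  | var (v : ℕ)
  | arr (a : ℕ) (i : Term)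
  | add (x y : Term)
  | sub (x y : Term)
  | mul (x y : Term)
  | div (x y : Term)

/-- The value of a term. Subtraction is truncated at `0`, division is rounded down, and
division by `0` yields `0`. -/
def Term.eval (s : State) : Term → ℕ
  | .lit n => n
  | .var v => s.var v
  | .arr a i => s.arr a (i.eval s)
  | .add x y => x.eval s + y.eval s
  | .sub x y => x.eval s - y.eval s
  | .mul x y => x.eval s * y.eval s
  | .div x y => x.eval s / y.eval s

/-- The cost of evaluating a term: each node of the term is charged one unit plus the bit length of
its value, so that the operands of an operation are paid for as well. -/
def Term.cost (s : State) : Term → ℕ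
  | .lit n => 1 + n.size
  | .var v => 1 + (s.var v).size
  | .arr a i => i.cost s + (1 + (s.arr a (i.eval s)).size)
  | .add x y => x.cost s + y.cost s + (1 + (x.eval s + y.eval s).size)
  | .sub x y => x.cost s + y.cost s + (1 + (x.eval s - y.eval s).size)
  | .mul x y => x.cost s + y.cost s + (1 + (x.eval s * y.eval s).size)
  | .div x y => x.cost s + y.cost s + (1 + (x.eval s / y.eval s).size)

/-- Programs. A test succeeds when the value of the term is nonzero. -/
inductive Program where
  | skip
  | assign (v : ℕ) (x : Term)
  | store (a : ℕ) (i x : Term)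
  | seq (c₁ c₂ : Program)
  | ite (x : Term) (c₁ c₂ : Program)
  | loop (x : Term) (c : Program)

/-- The state after writing `n` into register `v`. -/
def State.setVar (s : State) (v n : ℕ) : State :=
  { s with var := Function.update s.var v n }

/-- The state after writing `n` into cell `i` of array `a`. -/
def State.setArr (s : State) (a i n : ℕ) : State :=
  { s with arr := Function.update s.arr a (Function.update (s.arr a) i n) }

/-- `Exec c s s' t`: started in state `s`, the program `c` halts in state `s'` after a
computation of cost `t`. -/
inductive Exec : Program → State → State → ℕ → Prop where
  | skip (s : State) : Exec .skip s s 1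
  | assign (v : ℕ) (x : Term) (s : State) :
      Exec (.assign v x) s (s.setVar v (x.eval s)) (x.cost s + 1)
  | store (a : ℕ) (i x : Term) (s : State) :
      Exec (.store a i x) s (s.setArr a (i.eval s) (x.eval s)) (i.cost s + x.cost s + 1)
  | seq {c₁ c₂ : Program} {s s' s'' : State} {t₁ t₂ : ℕ} :
      Exec c₁ s s' t₁ → Exec c₂ s' s'' t₂ → Exec (.seq c₁ c₂) s s'' (t₁ + t₂)
  | iteTrue {x : Term} {c₁ c₂ : Program} {s s' : State} {t : ℕ} :
      x.eval s ≠ 0 → Exec c₁ s s' t → Exec (.ite x c₁ c₂) s s' (x.cost s + 1 + t)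
  | iteFalse {x : Term} {c₁ c₂ : Program} {s s' : State} {t : ℕ} :
      x.eval s = 0 → Exec c₂ s s' t → Exec (.ite x c₁ c₂) s s' (x.cost s + 1 + t)
  | loopDone {x : Term} {c : Program} {s : State} :
      x.eval s = 0 → Exec (.loop x c) s s (x.cost s + 1)
  | loopStep {x : Term} {c : Program} {s s' s'' : State} {t₁ t₂ : ℕ} :
      x.eval s ≠ 0 → Exec c s s' t₁ → Exec (.loop x c) s' s'' t₂ →
      Exec (.loop x c) s s'' (x.cost s + 1 + t₁ + t₂)

/-- The initial state on an input: the input is in array `0`, its number of entries is in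
register `0`, and everything else is `0`. -/
def initialState (input : List ℕ) : State where
  var v := if v = 0 then input.length else 0
  arr a i := if a = 0 then input.getD i 0 else 0

/-- On the given input, the program halts within cost `t`, with answer `1` in register `0` if `P`
holds and with answer `0` if `P` fails. -/
def DecidesWithin (c : Program) (input : List ℕ) (t : ℕ) (P : Prop) : Prop :=
  ∃ (s : State) (t' : ℕ), Exec c (initialState input) s t' ∧ t' ≤ t ∧
    (P → s.var 0 = 1) ∧ (¬ P → s.var 0 = 0)

/-- The length of an input, its entries being written in binary with a separator after each. -/
def inputLength (input : List ℕ) : ℕ := (input.map fun k => k.size + 1).sum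

/-- The largest number that occurs in an input. -/
def maxNumber (input : List ℕ) : ℕ := input.foldr max 0

/-- A decision problem, with the promise that the instances are `valid`, can be decided in
pseudopolynomial time: a single program decides all valid instances, in time polynomial in
the (binary) length of the input and the largest number that occurs in it. -/
def PseudoPolyTimeDecidable {α : Type} (encode : α → List ℕ) (valid answer : α → Prop) : Prop :=
  ∃ (c : Program) (p : Polynomial ℕ), ∀ a, valid a →
    DecidesWithin c (encode a) (p.eval (inputLength (encode a) + maxNumber (encode a))) (answer a)

end RAM

/-! ## The budget division problem -/

namespace BudgetDivision

/-- An instance with `n` agents and `m` projects; `demand i j` is the demand of agent `i` for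
project `j`. The total budget is `1`. -/
structure Instance where
  n : ℕ
  m : ℕ
  demand : Fin n → Fin m → ℚ
  demand_mem : ∀ i j, demand i j ∈ Set.Icc (0 : ℚ) 1
  sum_demand_le : ∀ i, ∑ j, demand i j ≤ 1

/-- `x` is a budget-feasible solution. -/
def Instance.BudgetFeasible (I : Instance) (x : Fin I.m → ℝ) : Prop :=
  (∀ j, x j ∈ Set.Icc (0 : ℝ) 1) ∧ ∑ j, x j ≤ 1

/-- Agent `i` is satisfied by `x`: she is locally satisfied for at least `τ` projects. -/
def Instance.Satisfied (I : Instance) (τ : ℕ) (x : Fin I.m → ℝ) (i : Fin I.n) : Prop :=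
  τ ≤ Set.ncard {j : Fin I.m | (I.demand i j : ℝ) ≤ x j}

/-- Some budget-feasible solution satisfies all agents. -/
def Instance.AllAgentsSat (I : Instance) (τ : ℕ) : Prop :=
  ∃ x : Fin I.m → ℝ, I.BudgetFeasible x ∧ ∀ i, I.Satisfied τ x i

/-- Every agent has total demand exactly `1`. -/
def Instance.Tight (I : Instance) : Prop := ∀ i, ∑ j, I.demand i j = 1

/-- The input that describes an instance: `n`, `m`, and then, row by row, the numerator and the
denominator (in lowest terms) of each demand. -/
def Instance.encode (I : Instance) : List ℕ :=
  I.n :: I.m :: (List.finRange I.n).flatMap fun i =>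
    (List.finRange I.m).flatMap fun j => [(I.demand i j).num.toNat, (I.demand i j).den]

end BudgetDivision

/-! ## Minimal solutions of the scaled problem -/

namespace BudgetDivision

/-! Multiplying all demands by the product `D` of their denominators makes the problem integral:
find a vector of natural numbers with sum at most `D` that dominates each agent's demand vector in
all coordinates but one (`Instance.allAgentsSat_iff`; rounding down loses nothing because the scaled
demands are integers). Solutions are searched agent by agent, keeping only the minimal ones. Every
minimal solution for `k + 1` agents is a minimal solution for `k` agents raised to the new demand in
all coordinates but one (`minimal_sol_succ_iff`). So the search is fast as soon as there are few
minimal solutions at each stage.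

This is where tightness enters. Let `x ≠ y` be minimal. An agent exempted at `a` by `x` and at `b ≠
a` by `y` is a conflict, to be seen as an edge of a bipartite graph. Since its demands sum to `D`,
the gains of `y` at `a` and of `x` at `b`, added to `∑ min (x, y)`, already reach `D`
(`Conflict.le_sum`). Two disjoint edges therefore use up both budgets, and `y` exceeds `x` in at
most two coordinates. If there are no two disjoint edges, all edges share an endpoint, and lowering
one of the vectors towards the other everywhere else contradicts minimality unless it exceeds the
other at most at that endpoint. Either way, one of the two exceeds the other in one or two
coordinates (`card_exceeds_le_two`).

The count then follows from the polynomial method (`card_minimal_le`). With `u` and `v` the numbers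
of coordinates in which `y` exceeds `x` and conversely, the function `(u - 1)(u - 2)(v - 1)(v - 2)`
of `y` vanishes at every minimal `y ≠ x` and equals `4` at `x`. Hence these functions are linearly
independent. As coordinates of minimal solutions are `0` or demands, they lie in the fourth power of
a space spanned by `2m(k + 1) + 1` threshold indicators. The bound does not involve `D`, whose bit
length is polynomial in the input, so the explicit program has polynomial cost. -/

/-- `x` is at least `w` in all coordinates except possibly one. -/
def AlmostCovers {m : ℕ} (x w : Fin m → ℕ) : Prop := ∃ l, ∀ j, j ≠ l → w j ≤ x j

/-- `x` is an integral solution with budget `D` for the agents `0, …, k - 1`. -/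
def Sol {m : ℕ} (d : ℕ → Fin m → ℕ) (D k : ℕ) (x : Fin m → ℕ) : Prop :=
  ∑ j, x j ≤ D ∧ ∀ i < k, AlmostCovers x (d i)

/-- The vector `x` raised to `w` in all coordinates but `l`. -/
def raise {m : ℕ} (x w : Fin m → ℕ) (l : Fin m) : Fin m → ℕ :=
  fun j => if j = l then x j else max (x j) (w j)

section

variable {m : ℕ} {d : ℕ → Fin m → ℕ} {D k : ℕ}

/-! ### Minimal solutions, one agent at a time. -/

lemma AlmostCovers.mono {x y w : Fin m → ℕ} (h : AlmostCovers x w) (hxy : x ≤ y) :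
    AlmostCovers y w := by
  obtain ⟨l, hl⟩ := h
  exact ⟨l, fun j hj => (hl j hj).trans (hxy j)⟩

lemma le_raise (x w : Fin m → ℕ) (l : Fin m) : x ≤ raise x w l := by
  intro j
  unfold raise
  split_ifs <;> simp

lemma almostCovers_raise (x w : Fin m → ℕ) (l : Fin m) : AlmostCovers (raise x w l) w :=
  ⟨l, fun j hj => by simp [raise, hj]⟩

lemma raise_le {x y w : Fin m → ℕ} {l : Fin m} (hxy : x ≤ y) (hl : ∀ j, j ≠ l → w j ≤ y j) :
    raise x w l ≤ y := by
  intro j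
  unfold raise
  split_ifs with h
  · exact hxy j
  · exact max_le (hxy j) (hl j h)

lemma exists_minimal_le {x : Fin m → ℕ} (hx : Sol d D k x) :
    ∃ y ≤ x, Minimal (Sol d D k) y :=
  exists_minimal_le_of_wellFoundedLT (Sol d D k) x hx

lemma minimal_sol_zero_iff {x : Fin m → ℕ} : Minimal (Sol d D 0) x ↔ x = 0 := by
  have h0 : Sol d D 0 (0 : Fin m → ℕ) := ⟨by simp, fun i hi => absurd hi (Nat.not_lt_zero i)⟩
  constructor
  · intro h
    exact le_antisymm (h.2 h0 (fun j => Nat.zero_le _)) (fun j => Nat.zero_le _)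
  · rintro rfl
    exact ⟨h0, fun y _ _ j => Nat.zero_le _⟩

lemma sol_succ_raise {x : Fin m → ℕ} {l : Fin m} (hx : Sol d D k x)
    (hs : ∑ j, raise x (d k) l j ≤ D) : Sol d D (k + 1) (raise x (d k) l) := by
  refine ⟨hs, fun i hi => ?_⟩
  rcases Nat.lt_succ_iff_lt_or_eq.mp hi with h | rfl
  · exact (hx.2 i h).mono (le_raise _ _ _)
  · exact almostCovers_raise _ _ _

/-- Every solution for `k + 1` agents lies above a raised minimal solution for `k` agents. -/
lemma exists_raise_le {y : Fin m → ℕ} (hy : Sol d D (k + 1) y) :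
    ∃ x l, Minimal (Sol d D k) x ∧ raise x (d k) l ≤ y := by
  obtain ⟨x, hxy, hx⟩ := exists_minimal_le (d := d) (D := D) (k := k)
    (x := y) ⟨hy.1, fun i hi => hy.2 i (hi.trans k.lt_succ_self)⟩
  obtain ⟨l, hl⟩ := hy.2 k k.lt_succ_self
  exact ⟨x, l, hx, raise_le hxy hl⟩

/-- The raised vectors are cofinal from below among the solutions for `k + 1` agents
(`exists_raise_le`), so it suffices to compare `y` with them. Competitors need no budget check: one
that lies below `y` inherits the budget from `y`. This is the finite criterion that the program
tests. -/
lemma minimal_sol_succ_iff {y : Fin m → ℕ} :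
    Minimal (Sol d D (k + 1)) y ↔
      ∑ j, y j ≤ D ∧ (∃ x l, Minimal (Sol d D k) x ∧ raise x (d k) l = y) ∧
        ∀ x l, Minimal (Sol d D k) x → raise x (d k) l ≤ y → y ≤ raise x (d k) l := by
  have sum_le {z : Fin m → ℕ} (hs : ∑ j, y j ≤ D) (hz : z ≤ y) : ∑ j, z j ≤ D :=
    (Finset.sum_le_sum fun j _ => hz j).trans hs
  constructor
  · intro h
    have key : ∀ x l, Minimal (Sol d D k) x → raise x (d k) l ≤ y → y ≤ raise x (d k) l :=
      fun x l hx hle => h.2 (sol_succ_raise hx.1 (sum_le h.1.1 hle)) hle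
    obtain ⟨x, l, hx, hle⟩ := exists_raise_le h.1
    exact ⟨h.1.1, ⟨x, l, hx, le_antisymm hle (key x l hx hle)⟩, key⟩
  · rintro ⟨hs, ⟨x, l, hx, rfl⟩, hmin⟩
    refine ⟨sol_succ_raise hx.1 hs, fun z hz hzy => ?_⟩
    obtain ⟨x', l', hx', hle⟩ := exists_raise_le hz
    exact (hmin x' l' hx' (hle.trans hzy)).trans hle

/-- Otherwise lowering the coordinate by one would violate no agent. This confines coordinates to `k
+ 1` values, independently of the budget. -/
lemma minimal_coord_eq {x : Fin m → ℕ} (hx : Minimal (Sol d D k) x) (j : Fin m) :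
    x j = 0 ∨ ∃ i < k, x j = d i j := by
  by_contra! hcon
  obtain ⟨h0, hne⟩ := hcon
  have hle : Function.update x j (x j - 1) ≤ x := by
    intro j'
    by_cases h : j' = j
    · subst h; simp
    · simp [h]
  have hsol : Sol d D k (Function.update x j (x j - 1)) := by
    refine ⟨(Finset.sum_le_sum fun j' _ => hle j').trans hx.1.1, fun i hi => ?_⟩
    obtain ⟨l, hl⟩ := hx.1.2 i hi
    refine ⟨l, fun j' hj' => ?_⟩
    have h1 := hl j' hj'
    by_cases h : j' = j
    · subst h
      have := hne i hi
      simp only [Function.update_self]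
      omega
    · simpa [h] using h1
  have := hx.2 hsol hle j
  simp only [Function.update_self] at this
  omega

/-! ### Comparing two minimal solutions through their conflicts. -/

/-- The coordinates in which `y` exceeds `x`. -/
def exceeds (x y : Fin m → ℕ) : Finset (Fin m) := Finset.univ.filter fun j => x j < y j

@[simp] lemma mem_exceeds {x y : Fin m → ℕ} {j : Fin m} : j ∈ exceeds x y ↔ x j < y j := by
  simp [exceeds]

lemma exceeds_nonempty {x y : Fin m → ℕ} (hx : Minimal (Sol d D k) x)
    (hy : Minimal (Sol d D k) y) (hne : x ≠ y) : (exceeds x y).Nonempty := by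
  by_contra h
  rw [Finset.not_nonempty_iff_eq_empty] at h
  have hyx : y ≤ x := by
    intro j
    by_contra hj
    have : j ∈ exceeds x y := mem_exceeds.mpr (not_le.mp hj)
    simp [h] at this
  exact hne (le_antisymm (hx.2 hy.1 hyx) hyx)

/-- An agent that rules out lowering `y` at `a` and `x` at `b` simultaneously. -/
def Conflict (d : ℕ → Fin m → ℕ) (k : ℕ) (x y : Fin m → ℕ) (a b : Fin m) : Prop :=
  ∃ i < k, x a < d i a ∧ y b < d i b ∧ a ≠ b ∧
    (∀ j, j ≠ a → d i j ≤ x j) ∧ ∀ j, j ≠ b → d i j ≤ y j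

lemma Conflict.symm {x y : Fin m → ℕ} {a b : Fin m} (h : Conflict d k x y a b) :
    Conflict d k y x b a := by
  obtain ⟨i, hi, h1, h2, h3, h4, h5⟩ := h
  exact ⟨i, hi, h2, h1, h3.symm, h5, h4⟩

/-- If all conflicts share the coordinate `a`, then `y` exceeds `x` at most there. -/
lemma eq_of_conflict_cover {x y : Fin m → ℕ} (hx : Sol d D k x) (hy : Minimal (Sol d D k) y)
    {a : Fin m} (hcov : ∀ a' b, Conflict d k x y a' b → a' = a) :
    ∀ j ∈ exceeds x y, j = a := by
  -- Lower `y` to `x` everywhere except at `a`. If this is still a solution, minimality of `y` gives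
  -- `y ≤ x` away from `a`.
  set z : Fin m → ℕ := fun j => if j = a then y j else min (x j) (y j) with hz
  have hzy : z ≤ y := by
    intro j
    simp only [hz]
    split_ifs <;> simp
  have hsol : Sol d D k z := by
    refine ⟨(Finset.sum_le_sum fun j _ => hzy j).trans hy.1.1, fun i hi => ?_⟩
    obtain ⟨p, hp⟩ := hx.2 i hi
    obtain ⟨q, hq⟩ := hy.1.2 i hi
    by_cases hpx : d i p ≤ x p
    -- An agent whom `x` serves in all coordinates only needs the exemption that `y` grants; the
    -- next case is the same with the roles exchanged.
    · refine ⟨q, fun j hj => ?_⟩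
      have h1 : d i j ≤ x j := by
        by_cases h : j = p
        · rw [h]; exact hpx
        · exact hp j h
      have h2 := hq j hj
      simp only [hz]
      split_ifs
      · exact h2
      · exact le_min h1 h2
    by_cases hqy : d i q ≤ y q
    · refine ⟨p, fun j hj => ?_⟩
      have h1 : d i j ≤ y j := by
        by_cases h : j = q
        · rw [h]; exact hqy
        · exact hq j h
      have h2 := hp j hj
      simp only [hz]
      split_ifs
      · exact h1
      · exact le_min h2 h1
    -- Now `x` fails the agent at `p` and `y` fails it at `q`. If `p ≠ q` this is a conflict, so `p
    -- = a`, and there `z` agrees with `y`.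
    refine ⟨q, fun j hj => ?_⟩
    have h2 := hq j hj
    simp only [hz]
    split_ifs with h
    · exact h2
    · refine le_min (hp j ?_) h2
      rintro rfl
      exact h (hcov j q ⟨i, hi, not_le.mp hpx, not_le.mp hqy, hj, hp, hq⟩)
  intro j hj
  by_contra hja
  have := hy.2 hsol hzy j
  rw [mem_exceeds] at hj
  simp only [hz, hja, if_false, le_min_iff] at this
  omega

/-- The increments at the two ends of a conflict exhaust the part of the budget that the
common lower bound of the two solutions leaves free. -/
lemma Conflict.le_sum {x y : Fin m → ℕ} {a b : Fin m} (hd : ∀ i < k, ∑ j, d i j = D)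
    (h : Conflict d k x y a b) :
    D ≤ ∑ j, min (x j) (y j) + (y a - x a) + (x b - y b) := by
  obtain ⟨i, hi, h1, h2, h3, h4, h5⟩ := h
  rw [← hd i hi]
  -- Off `a` the demand is at most `x`, off `b` at most `y`. Thus the minimum suffices except at
  -- `a`, where `y` is needed, and at `b`, where `x` is needed.
  have key : ∀ j, d i j ≤ min (x j) (y j) + (if j = a then y a - x a else 0) +
      (if j = b then x b - y b else 0) := by
    intro j
    by_cases hja : j = a
    · subst hja
      have := h5 j h3
      simp [h3]
      omega
    · by_cases hjb : j = b
      · subst hjb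
        have := h4 j hja
        simp [hja]
        omega
      · simp [hja, hjb, h4 j hja, h5 j hjb]
  calc ∑ j, d i j ≤ ∑ j, (min (x j) (y j) + (if j = a then y a - x a else 0) +
      (if j = b then x b - y b else 0)) := Finset.sum_le_sum fun j _ => key j
    _ = _ := by simp [Finset.sum_add_distrib]

lemma sum_min_add {x y : Fin m → ℕ} : ∑ j, min (x j) (y j) + ∑ j, (y j - x j) = ∑ j, y j := by
  rw [← Finset.sum_add_distrib]
  refine Finset.sum_congr rfl fun j _ => ?_
  omega

lemma add_le_sum_of_ne (f : Fin m → ℕ) {a b : Fin m} (hab : a ≠ b) : f a + f b ≤ ∑ j, f j := by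
  rw [← Finset.sum_pair hab]
  exact Finset.sum_le_sum_of_subset (Finset.subset_univ _)

/-- Adding `Conflict.le_sum` for both conflicts gives at least `2 * D`, while the two budget
constraints give at most `2 * D`. The gains of `y` at `a` and `a'` must then account for its whole
excess over `x`. -/
lemma card_exceeds_le_of_disjoint_conflicts {x y : Fin m → ℕ} {a b a' b' : Fin m}
    (hd : ∀ i < k, ∑ j, d i j = D) (hx : Sol d D k x) (hy : Sol d D k y)
    (h : Conflict d k x y a b) (h' : Conflict d k x y a' b') (haa : a ≠ a') (hbb : b ≠ b') :
    (exceeds x y).card ≤ 2 := by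
  have e1 := h.le_sum hd
  have e2 := h'.le_sum hd
  have s1 := sum_min_add (x := x) (y := y)
  have s2 := sum_min_add (x := y) (y := x)
  have c1 := hx.1
  have c2 := hy.1
  have t2 := add_le_sum_of_ne (fun j => x j - y j) hbb
  have comm : ∑ j, min (y j) (x j) = ∑ j, min (x j) (y j) :=
    Finset.sum_congr rfl fun j _ => min_comm _ _
  rw [comm] at s2
  have hsub : exceeds x y ⊆ {a, a'} := by
    intro j hj
    rw [mem_exceeds] at hj
    by_contra hmem
    simp only [Finset.mem_insert, Finset.mem_singleton, not_or] at hmem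
    -- A positive gain at a third coordinate `j` would make the sum of the two budget constraints
    -- strict.
    have t3 : ∑ l ∈ ({j, a, a'} : Finset (Fin m)), (y l - x l) ≤ ∑ l, (y l - x l) :=
      Finset.sum_le_sum_of_subset (Finset.subset_univ _)
    rw [Finset.sum_insert (by simp [hmem]), Finset.sum_pair haa] at t3
    omega
  exact (Finset.card_le_card hsub).trans Finset.card_le_two

/-- Of two distinct minimal solutions, one exceeds the other in at most two coordinates. -/
lemma card_exceeds_le_two {x y : Fin m → ℕ} (hd : ∀ i < k, ∑ j, d i j = D)
    (hx : Minimal (Sol d D k) x) (hy : Minimal (Sol d D k) y) (hne : x ≠ y) :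
    (exceeds x y).card ≤ 2 ∨ (exceeds y x).card ≤ 2 := by
  have single {s : Finset (Fin m)} {a : Fin m} (h : ∀ j ∈ s, j = a) : s.card ≤ 2 := by
    have : s ⊆ {a} := fun j hj => by simpa using h j hj
    exact (Finset.card_le_card this).trans (by simp)
  have coverLeft (a : Fin m) : (exceeds x y).card ≤ 2 ∨ ∃ a' b, Conflict d k x y a' b ∧ a' ≠ a := by
    by_contra! hcon
    exact absurd (single (eq_of_conflict_cover hx.1 hy hcon.2)) (not_le.mpr hcon.1)
  have coverRight (b : Fin m) :
      (exceeds y x).card ≤ 2 ∨ ∃ a b', Conflict d k x y a b' ∧ b' ≠ b := by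
    by_contra! hcon
    exact absurd (single (eq_of_conflict_cover hy.1 hx
      fun b' a h => hcon.2 a b' h.symm)) (not_le.mpr hcon.1)
  have disj {a b a' b' : Fin m} (h : Conflict d k x y a b) (h' : Conflict d k x y a' b')
      (haa : a ≠ a') (hbb : b ≠ b') :=
    card_exceeds_le_of_disjoint_conflicts hd hx.1 hy.1 h h' haa hbb
  -- The coordinate `a₀` is arbitrary; it only serves to extract a first conflict.
  obtain ⟨a₀, -⟩ := exceeds_nonempty hx hy hne
  rcases coverLeft a₀ with h | ⟨a₁, b₁, h₁, -⟩
  · exact Or.inl h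
  rcases coverLeft a₁ with h | ⟨a₂, b₂, h₂, ha₂⟩
  · exact Or.inl h
  -- Two edges with distinct left ends are now at hand. If they share the right end, a third edge
  -- avoiding that end is disjoint from at least one of them.
  by_cases hb : b₂ = b₁
  · subst hb
    rcases coverRight b₂ with h | ⟨a₃, b₃, h₃, hb₃⟩
    · exact Or.inr h
    by_cases ha : a₃ = a₁
    · exact Or.inl (disj h₃ h₂ (by rw [ha]; exact ha₂.symm) hb₃)
    · exact Or.inl (disj h₃ h₁ ha hb₃)
  · exact Or.inl (disj h₂ h₁ ha₂ hb)

/-! ### Counting minimal solutions by linear independence. -/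

/-- The threshold values that a minimal solution can take in coordinate `j`. -/
def threshold (d : ℕ → Fin m → ℕ) (k : ℕ) (j : Fin m) : Option (Fin k) → ℕ
  | none => 0
  | some i => d i j

/-- The indicator functions of exceeding, respectively staying below, a threshold. -/
noncomputable def thresholdIndicator (d : ℕ → Fin m → ℕ) (k : ℕ) :
    Option (Bool × Fin m × Option (Fin k)) → (Fin m → ℕ) → ℚ
  | none, _ => 1
  | some (true, j, o), y => if threshold d k j o < y j then 1 else 0
  | some (false, j, o), y => if y j < threshold d k j o then 1 else 0

lemma exists_threshold_eq {x : Fin m → ℕ} (hx : Minimal (Sol d D k) x) (j : Fin m) :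
    ∃ o, x j = threshold d k j o := by
  rcases minimal_coord_eq hx j with h | ⟨i, hi, h⟩
  · exact ⟨none, h⟩
  · exact ⟨some ⟨i, hi⟩, h⟩

/-- A family of functions, each nonzero at its own point and zero at the points of the others, is at
most as large as a finite set that spans it. -/
lemma card_le_of_diagonal {α : Type*} (F : Finset α) (f : α → α → ℚ) (W : Finset (α → ℚ))
    (hdiag : ∀ x ∈ F, f x x ≠ 0) (hoff : ∀ x ∈ F, ∀ y ∈ F, x ≠ y → f x y = 0)
    (hspan : ∀ x ∈ F, f x ∈ Submodule.span ℚ (W : Set (α → ℚ))) : F.card ≤ W.card := by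
  have hli : LinearIndependent ℚ fun x : F => f x := by
    rw [Fintype.linearIndependent_iff]
    intro g hg x
    have := congrFun hg x
    rw [Finset.sum_apply, Finset.sum_eq_single x] at this
    · simpa [hdiag x x.2] using this
    · intro y _ hyx
      simp [hoff y y.2 x x.2 fun h => hyx (Subtype.ext h)]
    · simp
  have := linearIndependent_le_span_aux' _ hli (W : Set (α → ℚ)) (by
    rintro _ ⟨x, rfl⟩
    exact hspan x x.2)
  simpa using this

open Classical Pointwise in
/-- There are only polynomially many minimal solutions. -/
theorem card_minimal_le (hd : ∀ i < k, ∑ j, d i j = D) (F : Finset (Fin m → ℕ))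
    (hF : ∀ x ∈ F, Minimal (Sol d D k) x) : F.card ≤ (2 * (m * (k + 1)) + 1) ^ 4 := by
  set Φ : Finset ((Fin m → ℕ) → ℚ) := Finset.univ.image (thresholdIndicator d k) with hΦ
  set M : Submodule ℚ ((Fin m → ℕ) → ℚ) := Submodule.span ℚ (Φ : Set _) with hM
  have hmem (o) : thresholdIndicator d k o ∈ M :=
    Submodule.subset_span (Finset.mem_coe.mpr (Finset.mem_image_of_mem _ (Finset.mem_univ o)))
  have hone : (1 : (Fin m → ℕ) → ℚ) ∈ M := hmem none
  let up (x : Fin m → ℕ) : (Fin m → ℕ) → ℚ := fun y => (exceeds x y).card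
  let down (x : Fin m → ℕ) : (Fin m → ℕ) → ℚ := fun y => (exceeds y x).card
  have hup {x} (hx : Minimal (Sol d D k) x) : up x ∈ M := by
    choose o ho using exists_threshold_eq hx
    have : up x = ∑ j, thresholdIndicator d k (some (true, j, o j)) := by
      funext y
      simp [up, exceeds, thresholdIndicator, ← ho, Finset.sum_apply]
    rw [this]
    exact Submodule.sum_mem _ fun j _ => hmem _
  have hdown {x} (hx : Minimal (Sol d D k) x) : down x ∈ M := by
    choose o ho using exists_threshold_eq hx
    have : down x = ∑ j, thresholdIndicator d k (some (false, j, o j)) := by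
      funext y
      simp [down, exceeds, thresholdIndicator, ← ho, Finset.sum_apply]
    rw [this]
    exact Submodule.sum_mem _ fun j _ => hmem _
  -- Both excess counts are positive at any other minimal solution and one of them is at most `2`,
  -- so a factor vanishes; at `x` itself both are `0` and the value is `(-1)(-2)(-1)(-2)`.
  let f (x : Fin m → ℕ) : (Fin m → ℕ) → ℚ :=
    (up x - 1) * (up x - (2 : ℚ) • 1) * (down x - 1) * (down x - (2 : ℚ) • 1)
  have hf {x} (hx : Minimal (Sol d D k) x) : f x ∈ M ^ 4 := by
    have h2 := M.smul_mem 2 hone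
    rw [pow_succ, pow_succ, pow_succ, pow_one]
    exact Submodule.mul_mem_mul (Submodule.mul_mem_mul (Submodule.mul_mem_mul
      (M.sub_mem (hup hx) hone) (M.sub_mem (hup hx) h2)) (M.sub_mem (hdown hx) hone))
      (M.sub_mem (hdown hx) h2)
  have hself (x) : f x x = 4 := by
    have : exceeds x x = ∅ := by simp [exceeds]
    simp [f, up, down, this]
    norm_num
  have hoff {x y} (hx : Minimal (Sol d D k) x) (hy : Minimal (Sol d D k) y) (hne : x ≠ y) :
      f x y = 0 := by
    have two {c : ℕ} (h1 : 0 < c) (h2 : c ≤ 2) : ((c : ℚ) - 1) * ((c : ℚ) - 2) = 0 := by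
      interval_cases c <;> norm_num
    have p1 := (exceeds_nonempty hx hy hne).card_pos
    have p2 := (exceeds_nonempty hy hx hne.symm).card_pos
    have hfy : f x y = (((exceeds x y).card : ℚ) - 1) * ((exceeds x y).card - 2) *
        ((((exceeds y x).card : ℚ) - 1) * ((exceeds y x).card - 2)) := by
      simp [f, up, down]
      ring
    rw [hfy]
    rcases card_exceeds_le_two hd hx hy hne with h | h
    · rw [two p1 h, zero_mul]
    · rw [two p2 h, mul_zero]
  have hspan : ∀ x ∈ F, f x ∈ Submodule.span ℚ ((Φ ^ 4 : Finset _) : Set ((Fin m → ℕ) → ℚ)) := by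
    intro x hx
    rw [Finset.coe_pow, ← Submodule.span_pow]
    exact hf (hF x hx)
  have := card_le_of_diagonal F f (Φ ^ 4) (fun x _ => by rw [hself]; norm_num)
    (fun x hx y hy => hoff (hF x hx) (hF y hy)) hspan
  have hcard : Φ.card ≤ 2 * (m * (k + 1)) + 1 := by
    refine Finset.card_image_le.trans ?_
    simp
  exact this.trans (Finset.card_pow_le.trans (Nat.pow_le_pow_left hcard 4))

end

end BudgetDivision

/-! ## Counting steps of programs with bounded memory contents -/

namespace RAM

/-- All memory contents are less than `2 ^ K`. -/
def State.Bounded (K : ℕ) (s : State) : Prop :=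
  (∀ v, s.var v < 2 ^ K) ∧ ∀ a i, s.arr a i < 2 ^ K

/-- A bound for the bit length of a term and of its subterms, relative to a bound for the memory. -/
def Term.weight : Term → ℕ
  | .lit n => n.size + 1
  | .var _ => 1
  | .arr _ i => i.weight + 1
  | .add x y => x.weight + y.weight + 1
  | .sub x y => x.weight + y.weight + 1
  | .mul x y => x.weight + y.weight + 1
  | .div x y => x.weight + y.weight + 1

/-- The weight of all terms of a program. -/
def Program.weight : Program → ℕ
  | .skip => 1
  | .assign _ x => x.weight ^ 2 * 2 + 1
  | .store _ i x => i.weight ^ 2 * 2 + x.weight ^ 2 * 2 + 1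
  | .seq c₁ c₂ => c₁.weight + c₂.weight
  | .ite x c₁ c₂ => x.weight ^ 2 * 2 + 1 + c₁.weight + c₂.weight
  | .loop x c => x.weight ^ 2 * 2 + 1 + c.weight

/-- `Runs K c s s' k`: started in `s`, the program `c` halts in `s'` after at most `k` elementary
steps, which write only numbers less than `2 ^ K`. -/
inductive Runs (K : ℕ) : Program → State → State → ℕ → Prop where
  | skip (s : State) : Runs K .skip s s 1
  | assign (v : ℕ) (x : Term) (s : State) : x.eval s < 2 ^ K →
      Runs K (.assign v x) s (s.setVar v (x.eval s)) 1
  | store (a : ℕ) (i x : Term) (s : State) : x.eval s < 2 ^ K →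
      Runs K (.store a i x) s (s.setArr a (i.eval s) (x.eval s)) 1
  | seq {c₁ c₂ : Program} {s s' s'' : State} {t₁ t₂ : ℕ} :
      Runs K c₁ s s' t₁ → Runs K c₂ s' s'' t₂ → Runs K (.seq c₁ c₂) s s'' (t₁ + t₂)
  | iteTrue {x : Term} {c₁ c₂ : Program} {s s' : State} {t : ℕ} :
      x.eval s ≠ 0 → Runs K c₁ s s' t → Runs K (.ite x c₁ c₂) s s' (1 + t)
  | iteFalse {x : Term} {c₁ c₂ : Program} {s s' : State} {t : ℕ} :
      x.eval s = 0 → Runs K c₂ s s' t → Runs K (.ite x c₁ c₂) s s' (1 + t)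
  | loopDone {x : Term} {c : Program} {s : State} :
      x.eval s = 0 → Runs K (.loop x c) s s 1
  | loopStep {x : Term} {c : Program} {s s' s'' : State} {t₁ t₂ : ℕ} :
      x.eval s ≠ 0 → Runs K c s s' t₁ → Runs K (.loop x c) s' s'' t₂ →
      Runs K (.loop x c) s s'' (1 + t₁ + t₂)
  | mono {c : Program} {s s' : State} {k k' : ℕ} : Runs K c s s' k → k ≤ k' → Runs K c s s' k'

lemma Term.weight_pos (x : Term) : 1 ≤ x.weight := by
  cases x <;> simp [Term.weight]

/-- Under each arithmetic operation the bit lengths of the operands at most add up, plus one, and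
`weight` counts exactly this. An array access is bounded by `K` whatever its index. -/
lemma Term.eval_lt {K : ℕ} {s : State} (hs : s.Bounded K) (x : Term) :
    x.eval s < 2 ^ (x.weight * (K + 1)) := by
  have two (a b : ℕ) : 2 ^ a ≤ 2 ^ (a + b + 1) ∧ 2 ^ a + 2 ^ b ≤ 2 ^ (a + b + 1) ∧
      2 ^ a * 2 ^ b ≤ 2 ^ (a + b + 1) := by
    have ha := Nat.one_le_two_pow (n := a)
    have hb := Nat.one_le_two_pow (n := b)
    have : 2 ^ (a + b + 1) = 2 * (2 ^ a * 2 ^ b) := by ring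
    rw [this]
    refine ⟨by nlinarith, by nlinarith, by nlinarith⟩
  have step (a b : ℕ) : 2 ^ (a * (K + 1) + b * (K + 1) + 1) ≤ 2 ^ ((a + b + 1) * (K + 1)) :=
    Nat.pow_le_pow_right (by norm_num) (by nlinarith)
  induction x with
  | lit n =>
    refine (Nat.lt_size_self n).trans_le (Nat.pow_le_pow_right (by norm_num) ?_)
    simp only [Term.weight]
    nlinarith
  | var v =>
    refine (hs.1 v).trans_le (Nat.pow_le_pow_right (by norm_num) ?_)
    simp [Term.weight]
  | arr a i _ =>
    refine (hs.2 a _).trans_le (Nat.pow_le_pow_right (by norm_num) ?_)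
    simp only [Term.weight]
    nlinarith
  | add x y hx hy =>
    exact (Nat.add_lt_add hx hy).trans_le ((two _ _).2.1.trans (step _ _))
  | sub x y hx hy =>
    exact ((Nat.sub_le _ _).trans_lt hx).trans_le ((two _ _).1.trans (step _ _))
  | mul x y hx hy =>
    exact (Nat.mul_lt_mul'' hx hy).trans_le ((two _ _).2.2.trans (step _ _))
  | div x y hx hy =>
    exact ((Nat.div_le_self _ _).trans_lt hx).trans_le ((two _ _).1.trans (step _ _))

/-- There are at most `weight` nodes, and each is charged one plus a bit length of at most `weight *
(K + 1)`; hence the square. -/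
lemma Term.cost_le {K : ℕ} {s : State} (hs : s.Bounded K) (x : Term) :
    x.cost s ≤ x.weight ^ 2 * 2 * (K + 1) := by
  have hsize (x : Term) : 1 + (x.eval s).size ≤ 1 + x.weight * (K + 1) :=
    Nat.add_le_add_left (Nat.size_le.mpr (x.eval_lt hs)) 1
  have step (a b : ℕ) (ha : 1 ≤ a) : a ^ 2 * 2 * (K + 1) + b ^ 2 * 2 * (K + 1) +
      (1 + (a + b + 1) * (K + 1)) ≤ (a + b + 1) ^ 2 * 2 * (K + 1) := by
    have : a ^ 2 * 2 + b ^ 2 * 2 + (1 + (a + b + 1)) ≤ (a + b + 1) ^ 2 * 2 := by nlinarith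
    have := Nat.mul_le_mul_right (K + 1) this
    nlinarith
  have unit (a : ℕ) (ha : 1 ≤ a) : 1 + a * (K + 1) ≤ a ^ 2 * 2 * (K + 1) := by
    have : 1 + a ≤ a ^ 2 * 2 := by nlinarith
    have := Nat.mul_le_mul_right (K + 1) this
    nlinarith
  induction x with
  | lit n => exact (hsize (.lit n)).trans (unit _ (Term.weight_pos _))
  | var v => exact (hsize (.var v)).trans (unit _ (Term.weight_pos _))
  | arr a i hi =>
    have h := step i.weight 0 i.weight_pos
    have h' := hsize (.arr a i)
    simp only [Term.cost, Term.weight] at h' ⊢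
    simp only [Term.eval] at h'
    simp only [add_zero] at h
    omega
  | add x y hx hy =>
    exact (Nat.add_le_add (Nat.add_le_add hx hy) (hsize (.add x y))).trans
      (step _ _ x.weight_pos)
  | sub x y hx hy =>
    exact (Nat.add_le_add (Nat.add_le_add hx hy) (hsize (.sub x y))).trans
      (step _ _ x.weight_pos)
  | mul x y hx hy =>
    exact (Nat.add_le_add (Nat.add_le_add hx hy) (hsize (.mul x y))).trans
      (step _ _ x.weight_pos)
  | div x y hx hy =>
    exact (Nat.add_le_add (Nat.add_le_add hx hy) (hsize (.div x y))).trans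
      (step _ _ x.weight_pos)

lemma State.Bounded.setVar {K : ℕ} {s : State} (hs : s.Bounded K) (v : ℕ) {n : ℕ}
    (hn : n < 2 ^ K) : (s.setVar v n).Bounded K := by
  refine ⟨fun w => ?_, hs.2⟩
  by_cases h : w = v
  · subst h; simpa [State.setVar] using hn
  · simpa [State.setVar, h] using hs.1 w

lemma State.Bounded.setArr {K : ℕ} {s : State} (hs : s.Bounded K) (a i : ℕ) {n : ℕ}
    (hn : n < 2 ^ K) : (s.setArr a i n).Bounded K := by
  refine ⟨hs.1, fun b j => ?_⟩
  by_cases h : b = a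
  · subst h
    by_cases h' : j = i
    · subst h'; simpa [State.setArr] using hn
    · simpa [State.setArr, h'] using hs.2 b j
  · simpa [State.setArr, h] using hs.2 b j

/-- The logarithmic cost is bounded by the number of steps times the bit length of the memory
contents, up to a factor depending on the program. -/
theorem Runs.exec {K : ℕ} {c : Program} {s s' : State} {k : ℕ} (h : Runs K c s s' k)
    (hs : s.Bounded K) :
    s'.Bounded K ∧ ∃ t, Exec c s s' t ∧ t ≤ k * (c.weight * (K + 1)) := by
  induction h with
  | skip s => exact ⟨hs, 1, .skip s, by simp [Program.weight]⟩
  | assign v x s hx =>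
    refine ⟨hs.setVar v hx, _, .assign v x s, ?_⟩
    have := x.cost_le hs
    simp only [Program.weight]
    nlinarith
  | store a i x s hx =>
    refine ⟨hs.setArr a _ hx, _, .store a i x s, ?_⟩
    have := x.cost_le hs
    have := i.cost_le hs
    simp only [Program.weight]
    nlinarith
  | @seq c₁ c₂ _ _ _ t₁ t₂ _ _ ih₁ ih₂ =>
    obtain ⟨b₁, u₁, e₁, l₁⟩ := ih₁ hs
    obtain ⟨b₂, u₂, e₂, l₂⟩ := ih₂ b₁
    refine ⟨b₂, _, .seq e₁ e₂, (Nat.add_le_add l₁ l₂).trans ?_⟩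
    rw [add_mul]
    simp only [Program.weight]
    gcongr <;> omega
  | @iteTrue x c₁ c₂ _ _ t hx _ ih =>
    obtain ⟨b, u, e, l⟩ := ih hs
    refine ⟨b, _, .iteTrue hx e, (Nat.add_le_add (Nat.add_le_add_right (x.cost_le hs) 1) l).trans ?_⟩
    rw [add_mul, one_mul]
    refine Nat.add_le_add ?_ (by gcongr; simp only [Program.weight]; omega)
    have : x.weight ^ 2 * 2 + 1 ≤ (Program.ite x c₁ c₂).weight := by
      simp only [Program.weight]; omega
    nlinarith [Nat.mul_le_mul_right (K + 1) this]
  | @iteFalse x c₁ c₂ _ _ t hx _ ih =>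
    obtain ⟨b, u, e, l⟩ := ih hs
    refine ⟨b, _, .iteFalse hx e,
      (Nat.add_le_add (Nat.add_le_add_right (x.cost_le hs) 1) l).trans ?_⟩
    rw [add_mul, one_mul]
    refine Nat.add_le_add ?_ (by gcongr; simp only [Program.weight]; omega)
    have : x.weight ^ 2 * 2 + 1 ≤ (Program.ite x c₁ c₂).weight := by
      simp only [Program.weight]; omega
    nlinarith [Nat.mul_le_mul_right (K + 1) this]
  | @loopDone x c _ hx =>
    refine ⟨hs, _, .loopDone hx, ?_⟩
    have := x.cost_le hs
    have : x.weight ^ 2 * 2 + 1 ≤ (Program.loop x c).weight := by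
      simp only [Program.weight]; omega
    nlinarith [Nat.mul_le_mul_right (K + 1) this]
  | @loopStep x c _ _ _ t₁ t₂ hx _ _ ih₁ ih₂ =>
    obtain ⟨b₁, u₁, e₁, l₁⟩ := ih₁ hs
    obtain ⟨b₂, u₂, e₂, l₂⟩ := ih₂ b₁
    refine ⟨b₂, _, .loopStep hx e₁ e₂, (Nat.add_le_add (Nat.add_le_add
      (Nat.add_le_add_right (x.cost_le hs) 1) l₁) l₂).trans ?_⟩
    rw [add_mul, add_mul, one_mul]
    refine Nat.add_le_add_right (Nat.add_le_add ?_ (by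
      gcongr; simp only [Program.weight]; omega)) _
    have : x.weight ^ 2 * 2 + 1 ≤ (Program.loop x c).weight := by
      simp only [Program.weight]; omega
    nlinarith [Nat.mul_le_mul_right (K + 1) this]
  | mono _ hk ih =>
    obtain ⟨b, u, e, l⟩ := ih hs
    exact ⟨b, u, e, l.trans (Nat.mul_le_mul_right _ hk)⟩

/-! ### Counting loops. -/

/-- The loop that runs `c` while counting the register `v` up to the value of `b`. -/
def Program.upTo (v : ℕ) (b : Term) (c : Program) : Program :=
  .loop (.sub b (.var v)) (.seq c (.assign v (.add (.var v) (.lit 1))))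

/-- The invariant rule for counting loops. -/
theorem Runs.upTo {K v : ℕ} {b : Term} {c : Program} {N k : ℕ} (Inv : ℕ → State → Prop)
    (hN : N < 2 ^ K) (hb : ∀ t s, t ≤ N → Inv t s → b.eval s = N ∧ s.var v = t)
    (hstep : ∀ t s, t < N → Inv t s →
      ∃ s', Runs K c s s' k ∧ s'.var v = t ∧ Inv (t + 1) (s'.setVar v (t + 1)))
    {t : ℕ} {s : State} (ht : t ≤ N) (hs : Inv t s) :
    ∃ s', Runs K (.upTo v b c) s s' ((N - t) * (k + 2) + 1) ∧ Inv N s' := by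
  induction h : N - t generalizing t s with
  | zero =>
    obtain rfl : t = N := by omega
    obtain ⟨h1, h2⟩ := hb t s ht hs
    exact ⟨s, (Runs.loopDone (by simp [Term.eval, h1, h2])).mono (by simp), hs⟩
  | succ r ih =>
    obtain ⟨h1, h2⟩ := hb t s ht hs
    obtain ⟨s₁, r₁, hv, hI⟩ := hstep t s (by omega) hs
    obtain ⟨s₂, r₂, hI₂⟩ := ih (by omega) hI (by omega)
    have hadd : (Term.add (.var v) (.lit 1)).eval s₁ = t + 1 := by simp [Term.eval, hv]
    have r₃ := Runs.assign (K := K) v (.add (.var v) (.lit 1)) s₁ (by rw [hadd]; omega)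
    rw [hadd] at r₃
    -- A round costs the test, the `k` steps of the body and the increment, whence the factor `k +
    -- 2`; the final failing test is the extra `1`.
    refine ⟨s₂, (Runs.loopStep (by simp only [Term.eval, h1, h2]; omega)
      (r₁.seq r₃) r₂).mono ?_, hI₂⟩
    ring_nf; omega

end RAM

/-! ## The program -/

namespace RAM

@[simp] lemma State.setVar_var (s : State) (v n w : ℕ) :
    (s.setVar v n).var w = if w = v then n else s.var w := by
  simp [State.setVar, Function.update_apply]

@[simp] lemma State.setVar_arr (s : State) (v n : ℕ) : (s.setVar v n).arr = s.arr := rfl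

@[simp] lemma State.setArr_var (s : State) (a i n : ℕ) : (s.setArr a i n).var = s.var := rfl

@[simp] lemma State.setArr_arr (s : State) (a i n b j : ℕ) :
    (s.setArr a i n).arr b j = if b = a ∧ j = i then n else s.arr b j := by
  by_cases hb : b = a
  · subst hb
    simp [State.setArr, Function.update_apply]
  · simp [State.setArr, hb]

lemma State.setVar_setVar (s : State) (v n n' : ℕ) :
    (s.setVar v n).setVar v n' = s.setVar v n' := by
  simp [State.setVar]

lemma State.setVar_comm (s : State) {v w : ℕ} (h : v ≠ w) (n n' : ℕ) :
    (s.setVar v n).setVar w n' = (s.setVar w n').setVar v n := by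
  simp [State.setVar, Function.update_comm h.symm]

lemma Runs.assign' {K v : ℕ} {x : Term} {s : State} {n : ℕ} (h : x.eval s = n) (hn : n < 2 ^ K) :
    Runs K (.assign v x) s (s.setVar v n) 1 := by
  subst h
  exact .assign v x s hn

/-- Sums the values of `T` over the values `0, …, m - 1` of register `14` into register `r`,
where `m` is in register `2`. -/
def sumUp (r : ℕ) (T : Term) : Program :=
  .seq (.assign r (.lit 0)) (.seq (.assign 14 (.lit 0))
    (.upTo 14 (.var 2) (.assign r (.add (.var r) T))))

/-- The hypothesis on `T` ranges over all contents `y` of register `r`, because the partial sum kept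
there changes during the loop. -/
lemma runs_sumUp {K r m : ℕ} {T : Term} {s : State} (f : ℕ → ℕ) (hr : r ≠ 14) (hr2 : r ≠ 2)
    (hm : s.var 2 = m) (hmK : m < 2 ^ K)
    (hT : ∀ y j, j < m → T.eval ((s.setVar r y).setVar 14 j) = f j)
    (hsum : ∑ j ∈ Finset.range m, f j < 2 ^ K) :
    Runs K (sumUp r T) s ((s.setVar r (∑ j ∈ Finset.range m, f j)).setVar 14 m) (m * 3 + 3) := by
  obtain ⟨s', h, rfl⟩ := Runs.upTo (K := K) (v := 14) (b := .var 2)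
    (c := .assign r (.add (.var r) T)) (N := m) (k := 1)
    (fun t s' => s' = (s.setVar r (∑ j ∈ Finset.range t, f j)).setVar 14 t) hmK
    (by
      rintro t s' - rfl
      simp [Term.eval, hm, hr2.symm])
    (by
      rintro t s' ht rfl
      have hle : ∑ j ∈ Finset.range (t + 1), f j ≤ ∑ j ∈ Finset.range m, f j :=
        Finset.sum_le_sum_of_subset (Finset.range_mono ht)
      refine ⟨_, .assign' (n := ∑ j ∈ Finset.range (t + 1), f j) ?_ (by omega), ?_, ?_⟩
      · simp [Term.eval, hT _ _ ht, hr, Finset.sum_range_succ]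
      · simp [hr.symm]
      · rw [State.setVar_comm _ hr, State.setVar_setVar, State.setVar_comm _ hr.symm,
          State.setVar_setVar])
    (t := 0) (s := (s.setVar r 0).setVar 14 0) (Nat.zero_le _) (by simp)
  exact ((Runs.assign' (by simp [Term.eval]) (by positivity)).seq
    ((Runs.assign' (by simp [Term.eval]) (by positivity)).seq h)).mono (by omega)

end RAM

namespace BudgetDivision

open RAM

/- Register `1` holds the number of agents, register `2` the number `m` of projects, register `3`
the common denominator `D` of the demands, register `5` the current agent. Array `1` holds a list
of vectors: coordinate `j` of the vector number `r` is in cell `r * m + j`. The vectors from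
register `6` up to register `7` are the minimal solutions for the agents before the current one,
those from register `7` up to register `8` are the solutions found for the current agent. -/

/-- The scaled demand of the current agent for project `j`. -/
def demandTerm (j : Term) : Term :=
  .mul (.arr 0 (.add (.lit 2) (.mul (.lit 2) (.add (.mul (.var 5) (.var 2)) j))))
    (.div (.var 3) (.arr 0 (.add (.lit 3) (.mul (.lit 2) (.add (.mul (.var 5) (.var 2)) j)))))

/-- The entry of the list that the candidate in register `r` modifies in coordinate `14`. -/
def baseTerm (r : ℕ) : Term :=
  .arr 1 (.add (.mul (.div (.var r) (.var 2)) (.var 2)) (.var 14))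

/-- The coordinate that the candidate in register `r` does not raise. -/
def freeTerm (r : ℕ) : Term :=
  .sub (.var r) (.mul (.div (.var r) (.var 2)) (.var 2))

/-- Coordinate `14` of the candidate whose number is in register `r`. -/
def candTerm (r : ℕ) : Term :=
  .add (baseTerm r) (.mul (.sub (demandTerm (.var 14)) (baseTerm r))
    (.sub (.lit 1) (.sub (.lit 1)
      (.add (.sub (.var 14) (freeTerm r)) (.sub (freeTerm r) (.var 14))))))

/-- Coordinate `j` of candidate `p`: the vector `p / m` of the list `A`, raised to `w` in all
coordinates but `p % m`. -/
def cand (m : ℕ) (w A : ℕ → ℕ) (p j : ℕ) : ℕ :=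
  if j = p % m then A (p / m * m + j) else max (A (p / m * m + j)) (w j)

/-- The penalty of candidate `p` caused by candidate `q`: nonzero when `q` is below `p`, and
different from it or earlier in the list. -/
def penalty (m : ℕ) (w A : ℕ → ℕ) (p q : ℕ) : ℕ :=
  (1 - ∑ j ∈ Finset.range m, (cand m w A q j - cand m w A p j)) *
    (∑ j ∈ Finset.range m, (cand m w A p j - cand m w A q j) + (p - q))

/-- Candidate `p` respects the budget and is the first of the minimal candidates equal to it. -/
def Keep (m D lo hi : ℕ) (w A : ℕ → ℕ) (p : ℕ) : Prop :=
  ∑ j ∈ Finset.range m, cand m w A p j ≤ D ∧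
    ∀ q, lo * m ≤ q → q < hi * m → (∀ j < m, cand m w A q j ≤ cand m w A p j) →
      (∀ j < m, cand m w A p j ≤ cand m w A q j) ∧ p ≤ q

/-- The content of the memory while an agent with demands `w` is processed. -/
structure Stage (m D lo hi : ℕ) (w A : ℕ → ℕ) (s : State) : Prop where
  m_eq : s.var 2 = m
  D_eq : s.var 3 = D
  lo_eq : s.var 6 = lo
  hi_eq : s.var 7 = hi
  demand_eq : ∀ j < m, (demandTerm (.lit j)).eval s = w j
  list_eq : ∀ i < hi * m, s.arr 1 i = A i

/-- Adds to register `10` the penalty of candidate `9` caused by candidate `11`. -/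
def addPenalty : Program :=
  .seq (sumUp 12 (.sub (candTerm 11) (candTerm 9)))
    (.seq (sumUp 13 (.sub (candTerm 9) (candTerm 11)))
      (.assign 10 (.add (.var 10) (.mul (.sub (.lit 1) (.var 12))
        (.add (.var 13) (.sub (.var 9) (.var 11)))))))

/-- Puts `0` into register `10` if candidate `9` is to be kept, and a positive number otherwise. -/
def testCandidate : Program :=
  .seq (sumUp 10 (candTerm 9)) (.seq (.assign 10 (.sub (.var 10) (.var 3)))
    (.seq (.assign 11 (.mul (.var 6) (.var 2)))
      (.upTo 11 (.mul (.var 7) (.var 2)) addPenalty)))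

/-- Appends candidate `9` to the list. -/
def appendCandidate : Program :=
  .seq (.assign 14 (.lit 0))
    (.seq (.upTo 14 (.var 2) (.store 1 (.add (.mul (.var 8) (.var 2)) (.var 14)) (candTerm 9)))
      (.assign 8 (.add (.var 8) (.lit 1))))

/-- Computes the minimal solutions that also satisfy the current agent. -/
def processAgent : Program :=
  .seq (.assign 9 (.mul (.var 6) (.var 2)))
    (.seq (.upTo 9 (.mul (.var 7) (.var 2))
        (.seq testCandidate (.ite (.var 10) .skip appendCandidate)))
      (.seq (.assign 6 (.var 7)) (.assign 7 (.var 8))))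

/-- The program for instances in which all total demands are equal to the budget. -/
def decideProgram : Program :=
  .seq (.assign 1 (.arr 0 (.lit 0))) (.seq (.assign 2 (.arr 0 (.lit 1)))
    (.seq (.assign 3 (.lit 1))
      (.seq (.upTo 4 (.mul (.var 1) (.var 2))
          (.assign 3 (.mul (.var 3) (.arr 0 (.add (.lit 3) (.mul (.lit 2) (.var 4)))))))
        (.seq (.assign 7 (.lit 1)) (.seq (.assign 8 (.lit 1))
          (.seq (.upTo 5 (.var 1) processAgent)
            (.assign 0 (.sub (.lit 1) (.sub (.lit 1) (.sub (.var 7) (.var 6)))))))))))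

/-! ### Execution of the parts of the program. -/

section

variable {m D lo hi : ℕ} {w A : ℕ → ℕ} {s s' : State}

lemma demandTerm_eval_congr {j : ℕ} {x : Term} (h2 : s'.var 2 = s.var 2) (h3 : s'.var 3 = s.var 3)
    (h5 : s'.var 5 = s.var 5) (h0 : s'.arr 0 = s.arr 0) (hx : x.eval s' = j) :
    (demandTerm x).eval s' = (demandTerm (.lit j)).eval s := by
  simp [demandTerm, Term.eval, h2, h3, h5, h0, hx]

lemma Stage.congr (h : Stage m D lo hi w A s) (hv : ∀ v < 8, s'.var v = s.var v)
    (h0 : s'.arr 0 = s.arr 0) (h1 : ∀ i < hi * m, s'.arr 1 i = s.arr 1 i) :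
    Stage m D lo hi w A s' where
  m_eq := by rw [hv 2 (by norm_num), h.m_eq]
  D_eq := by rw [hv 3 (by norm_num), h.D_eq]
  lo_eq := by rw [hv 6 (by norm_num), h.lo_eq]
  hi_eq := by rw [hv 7 (by norm_num), h.hi_eq]
  demand_eq j hj := by
    rw [demandTerm_eval_congr (hv 2 (by norm_num)) (hv 3 (by norm_num)) (hv 5 (by norm_num)) h0
      (j := j) rfl, h.demand_eq j hj]
  list_eq i hi := by rw [h1 i hi, h.list_eq i hi]

lemma cand_index_lt {p j : ℕ} (hp : p < hi * m) (hj : j < m) : p / m * m + j < hi * m := by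
  have h1 : p / m < hi := Nat.div_lt_of_lt_mul (by rwa [mul_comm])
  calc p / m * m + j < p / m * m + m := by omega
    _ = (p / m + 1) * m := by ring
    _ ≤ hi * m := Nat.mul_le_mul_right _ h1

lemma Stage.candTerm_eval (h : Stage m D lo hi w A s) {r p j : ℕ} (hr : s.var r = p)
    (hp : p < hi * m) (h14 : s.var 14 = j) (hj : j < m) :
    (candTerm r).eval s = cand m w A p j := by
  have hbase : (baseTerm r).eval s = A (p / m * m + j) := by
    rw [← h.list_eq _ (cand_index_lt hp hj)]
    simp [baseTerm, Term.eval, hr, h14, h.m_eq]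
  have hfree : (freeTerm r).eval s = p % m := by
    have := Nat.div_add_mod p m
    simp only [freeTerm, Term.eval, hr, h.m_eq]
    rw [mul_comm]
    omega
  have hdem : (demandTerm (.var 14)).eval s = w j := by
    rw [demandTerm_eval_congr (s := s) rfl rfl rfl rfl (j := j) (by simpa [Term.eval] using h14),
      h.demand_eq j hj]
  simp only [candTerm, Term.eval, hbase, hfree, hdem, h14, cand]
  split_ifs with hc
  · subst hc
    simp
  -- With truncated subtraction, `1 - (1 - |j - l|)` is the indicator of `j ≠ l`, and a base `b`
  -- plus `w - b` is the maximum of `b` and `w`.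
  · have : 1 - (1 - (j - p % m + (p % m - j))) = 1 := by omega
    rw [this]
    omega

lemma cand_le (hA : ∀ i < hi * m, A i ≤ D) (hw : ∀ j < m, w j ≤ D) {p j : ℕ} (hp : p < hi * m)
    (hj : j < m) : cand m w A p j ≤ D := by
  have h1 := hA _ (cand_index_lt hp hj)
  have h2 := hw j hj
  unfold cand
  split_ifs
  · exact h1
  · exact max_le h1 h2

lemma sum_range_le_mul {f : ℕ → ℕ} (h : ∀ j < m, f j ≤ D) : ∑ j ∈ Finset.range m, f j ≤ m * D := by
  simpa using Finset.sum_le_card_nsmul (Finset.range m) f D fun j hj => h j (Finset.mem_range.mp hj)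

lemma penalty_le (hA : ∀ i < hi * m, A i ≤ D) (hw : ∀ j < m, w j ≤ D) {p : ℕ} (hp : p < hi * m)
    (q : ℕ) : penalty m w A p q ≤ m * D + hi * m := by
  have h1 := sum_range_le_mul (m := m) (D := D) (f := fun j => cand m w A p j - cand m w A q j)
    fun j hj => (Nat.sub_le _ _).trans (cand_le hA hw hp hj)
  unfold penalty
  calc _ ≤ 1 * (m * D + hi * m) := Nat.mul_le_mul (Nat.sub_le _ _) (by omega)
    _ = _ := one_mul _

/-- A sum of truncated differences vanishes exactly when the first vector is below the second. So
the first factor is the indicator of `q` lying below `p`, and the second vanishes only if also `p`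
lies below `q` and does not come later. -/
lemma penalty_eq_zero_iff {p q : ℕ} : penalty m w A p q = 0 ↔
    ((∀ j < m, cand m w A q j ≤ cand m w A p j) →
      (∀ j < m, cand m w A p j ≤ cand m w A q j) ∧ p ≤ q) := by
  have key (a b : ℕ) : ∑ j ∈ Finset.range m, (cand m w A a j - cand m w A b j) = 0 ↔
      ∀ j < m, cand m w A a j ≤ cand m w A b j := by
    simp [Finset.sum_eq_zero_iff, Nat.sub_eq_zero_iff_le]
  rw [← key, ← key, ← Nat.sub_eq_zero_iff_le (m := q), penalty, Nat.mul_eq_zero]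
  omega

variable {K : ℕ}

/-- The registers and cells stay below `2 ^ K` while an agent is processed. -/
structure Room (K m D hi : ℕ) (w A : ℕ → ℕ) : Prop where
  list_le : ∀ i < hi * m, A i ≤ D
  demand_le : ∀ j < m, w j ≤ D
  lt : (m * D + hi * m + hi + m + D + 1) ^ 2 + (m * D + hi * m + hi + m + D + 1) < 2 ^ K

lemma Room.lin_lt (h : Room K m D hi w A) : m * D + hi * m + hi + m + D + 1 < 2 ^ K :=
  (Nat.le_add_left _ _).trans_lt h.lt

lemma runs_addPenalty (R : Room K m D hi w A) (h : Stage m D lo hi w A s) {p q b : ℕ}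
    (h9 : s.var 9 = p) (hp : p < hi * m) (h11 : s.var 11 = q) (hq : q < hi * m)
    (h10 : s.var 10 = b) (hb : b + penalty m w A p q < 2 ^ K) :
    ∃ s', Runs K addPenalty s s' (m * 6 + 7) ∧ s'.arr = s.arr ∧
      (∀ v < 10, s'.var v = s.var v) ∧ s'.var 11 = q ∧ s'.var 10 = b + penalty m w A p q := by
  have lin := R.lin_lt
  have le1 := sum_range_le_mul (m := m) (D := D) (f := fun j => cand m w A q j - cand m w A p j)
    fun j hj => (Nat.sub_le _ _).trans (cand_le R.list_le R.demand_le hq hj)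
  have le2 := sum_range_le_mul (m := m) (D := D) (f := fun j => cand m w A p j - cand m w A q j)
    fun j hj => (Nat.sub_le _ _).trans (cand_le R.list_le R.demand_le hp hj)
  have small {s₁ : State} {r : ℕ} (hr : 8 ≤ r) (y : ℕ) {v : ℕ} (hv : v < 8) :
      (s₁.setVar r y).var v = s₁.var v := by
    rw [State.setVar_var, if_neg (by omega)]
  have st (s₁ : State) (h₁ : Stage m D lo hi w A s₁) (r : ℕ) (hr : 8 ≤ r) (y : ℕ) :
      Stage m D lo hi w A (s₁.setVar r y) :=
    h₁.congr (fun v hv => small hr y hv) rfl fun _ _ => rfl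
  have run1 := runs_sumUp (K := K) (r := 12) (T := .sub (candTerm 11) (candTerm 9)) (s := s)
    (fun j => cand m w A q j - cand m w A p j) (by norm_num) (by norm_num) h.m_eq (by omega)
    (fun y j hj => by
      have h' := st _ (st s h 12 (by norm_num) y) 14 (by norm_num) j
      simp only [Term.eval]
      rw [h'.candTerm_eval (p := q) (j := j) (by simpa using h11) hq (by simp) hj,
        h'.candTerm_eval (p := p) (j := j) (by simpa using h9) hp (by simp) hj])
    (by omega)
  set s₁ := (s.setVar 12 (∑ j ∈ Finset.range m, (cand m w A q j - cand m w A p j))).setVar 14 m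
    with hs₁
  have h1 : Stage m D lo hi w A s₁ := st _ (st s h 12 (by norm_num) _) 14 (by norm_num) m
  have run2 := runs_sumUp (K := K) (r := 13) (T := .sub (candTerm 9) (candTerm 11)) (s := s₁)
    (fun j => cand m w A p j - cand m w A q j) (by norm_num) (by norm_num) h1.m_eq (by omega)
    (fun y j hj => by
      have h' := st _ (st s₁ h1 13 (by norm_num) y) 14 (by norm_num) j
      simp only [Term.eval]
      rw [h'.candTerm_eval (p := p) (j := j) (by simpa [hs₁] using h9) hp (by simp) hj,
        h'.candTerm_eval (p := q) (j := j) (by simpa [hs₁] using h11) hq (by simp) hj])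
    (by omega)
  refine ⟨_, (run1.seq (run2.seq (Runs.assign' (n := b + penalty m w A p q) ?_ hb))).mono
    (by omega), rfl, ?_, ?_, ?_⟩
  · simp [Term.eval, hs₁, h9, h10, h11, penalty]
  · intro v hv
    simp only [hs₁, State.setVar_var]
    rw [if_neg (by omega), if_neg (by omega), if_neg (by omega), if_neg (by omega),
      if_neg (by omega)]
  · simp [hs₁, h11]
  · simp

lemma runs_testCandidate (R : Room K m D hi w A) (h : Stage m D lo hi w A s) (hlo : lo ≤ hi)
    {p : ℕ} (h9 : s.var 9 = p) (hp : p < hi * m) :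
    ∃ s', Runs K testCandidate s s' (m * 3 + 6 + hi * m * (m * 6 + 9)) ∧ s'.arr = s.arr ∧
      (∀ v < 10, s'.var v = s.var v) ∧ (s'.var 10 = 0 ↔ Keep m D lo hi w A p) := by
  have lin := R.lin_lt
  have room := R.lt
  have hmul : lo * m ≤ hi * m := Nat.mul_le_mul_right _ hlo
  have le1 := sum_range_le_mul (m := m) (D := D) (f := fun j => cand m w A p j)
    fun j hj => cand_le R.list_le R.demand_le hp hj
  have st (s₁ : State) (h₁ : Stage m D lo hi w A s₁) (r : ℕ) (hr : 8 ≤ r) (y : ℕ) :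
      Stage m D lo hi w A (s₁.setVar r y) :=
    h₁.congr (fun v hv => by rw [State.setVar_var, if_neg (by omega)]) rfl fun _ _ => rfl
  have run1 := runs_sumUp (K := K) (r := 10) (T := candTerm 9) (s := s)
    (fun j => cand m w A p j) (by norm_num) (by norm_num) h.m_eq (by omega)
    (fun y j hj => by
      have h' := st _ (st s h 10 (by norm_num) y) 14 (by norm_num) j
      exact h'.candTerm_eval (p := p) (j := j) (by simpa using h9) hp (by simp) hj)
    (by omega)
  set c := ∑ j ∈ Finset.range m, cand m w A p j with hc
  have run2 : Runs K (.assign 10 (.sub (.var 10) (.var 3))) ((s.setVar 10 c).setVar 14 m)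
      (((s.setVar 10 c).setVar 14 m).setVar 10 (c - D)) 1 :=
    .assign' (by simp [Term.eval, h.D_eq]) (by omega)
  set s₂ := ((s.setVar 10 c).setVar 14 m).setVar 10 (c - D) with hs₂
  have run3 : Runs K (.assign 11 (.mul (.var 6) (.var 2))) s₂ (s₂.setVar 11 (lo * m)) 1 :=
    .assign' (by simp [Term.eval, hs₂, h.lo_eq, h.m_eq]) (by omega)
  have total_lt {t : ℕ} (ht : t ≤ hi * m) :
      c - D + ∑ q ∈ Finset.Ico (lo * m) t, penalty m w A p q < 2 ^ K := by
    have : ∑ q ∈ Finset.Ico (lo * m) t, penalty m w A p q ≤ hi * m * (m * D + hi * m) := by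
      refine (Finset.sum_le_card_nsmul _ _ _ fun q _ =>
        penalty_le R.list_le R.demand_le hp q).trans ?_
      rw [smul_eq_mul, Nat.card_Ico]
      exact Nat.mul_le_mul_right _ (by omega)
    -- Up to `hi * m` penalties accumulate, each at most `m * D + hi * m`; this is what the square
    -- in `Room.lt` pays for.
    have sq : hi * m * (m * D + hi * m) ≤ (m * D + hi * m + hi + m + D + 1) ^ 2 := by
      rw [pow_two]
      exact Nat.mul_le_mul (by omega) (by omega)
    omega
  obtain ⟨s', run4, e1, e2, e3, e4⟩ := Runs.upTo (K := K) (v := 11) (b := .mul (.var 7) (.var 2))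
    (c := addPenalty) (N := hi * m) (k := m * 6 + 7)
    (fun t s' => s'.arr = s.arr ∧ (∀ v < 10, s'.var v = s.var v) ∧ s'.var 11 = t ∧
      s'.var 10 = c - D + ∑ q ∈ Finset.Ico (lo * m) t, penalty m w A p q ∧ lo * m ≤ t)
    (by omega)
    (by
      rintro t s' - ⟨-, hv, ht, -⟩
      exact ⟨by simp [Term.eval, hv, h.hi_eq, h.m_eq], ht⟩)
    (by
      rintro t s' ht ⟨ha, hv, h11, h10, hlt⟩
      have hst : Stage m D lo hi w A s' :=
        h.congr (fun v hv' => hv v (by omega)) (by rw [ha]) fun _ _ => by rw [ha]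
      have hsum : ∑ q ∈ Finset.Ico (lo * m) (t + 1), penalty m w A p q =
          ∑ q ∈ Finset.Ico (lo * m) t, penalty m w A p q + penalty m w A p t :=
        Finset.sum_Ico_succ_top hlt _
      have := total_lt (t := t + 1) ht
      rw [hsum, ← add_assoc] at this
      obtain ⟨s'', r, f1, f2, f3, f4⟩ := runs_addPenalty R hst ((hv 9 (by norm_num)).trans h9) hp
        h11 ht h10 this
      refine ⟨s'', r, f3, f1.trans ha, fun v hv' => ?_, by simp, ?_, by omega⟩
      · rw [State.setVar_var, if_neg (by omega), f2 v hv', hv v hv']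
      · rw [State.setVar_var, if_neg (by omega), f4, hsum, add_assoc])
    (t := lo * m) (s := s₂.setVar 11 (lo * m)) hmul
    (by
      refine ⟨rfl, fun v hv => ?_, by simp, by simp [hs₂], le_rfl⟩
      simp only [hs₂, State.setVar_var]
      rw [if_neg (by omega), if_neg (by omega), if_neg (by omega), if_neg (by omega)])
  refine ⟨s', (run1.seq (run2.seq (run3.seq run4))).mono ?_, e1, e2, ?_⟩
  · have := Nat.mul_le_mul_right (m * 6 + 9) (Nat.sub_le (hi * m) (lo * m))
    have e : m * 6 + 7 + 2 = m * 6 + 9 := by ring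
    rw [e]
    omega
  · rw [e4.1, Nat.add_eq_zero_iff, Nat.sub_eq_zero_iff_le, Finset.sum_eq_zero_iff]
    simp only [Finset.mem_Ico, penalty_eq_zero_iff, Keep, and_imp, hc]

lemma runs_appendCandidate (R : Room K m D hi w A) (h : Stage m D lo hi w A s) {p e : ℕ}
    (h9 : s.var 9 = p) (hp : p < hi * m) (h8 : s.var 8 = e) (he : hi ≤ e) (heK : e + 1 < 2 ^ K) :
    ∃ s', Runs K appendCandidate s s' (m * 3 + 3) ∧ s'.arr 0 = s.arr 0 ∧
      (∀ v < 8, s'.var v = s.var v) ∧ s'.var 8 = e + 1 ∧ s'.var 9 = p ∧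
      (∀ i < e * m, s'.arr 1 i = s.arr 1 i) ∧
      ∀ j < m, s'.arr 1 (e * m + j) = cand m w A p j := by
  have lin := R.lin_lt
  have hmul : hi * m ≤ e * m := Nat.mul_le_mul_right _ he
  obtain ⟨s', run, e1, e2, e3, e4, e5⟩ := Runs.upTo (K := K) (v := 14) (b := .var 2)
    (c := .store 1 (.add (.mul (.var 8) (.var 2)) (.var 14)) (candTerm 9)) (N := m) (k := 1)
    (fun t s' => s'.arr 0 = s.arr 0 ∧ (∀ v < 10, s'.var v = s.var v) ∧ s'.var 14 = t ∧
      (∀ i < e * m, s'.arr 1 i = s.arr 1 i) ∧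
      ∀ j < t, s'.arr 1 (e * m + j) = cand m w A p j)
    (by omega)
    (by
      rintro t s' - ⟨-, hv, ht, -⟩
      exact ⟨by simp [Term.eval, hv, h.m_eq], ht⟩)
    (by
      rintro t s' ht ⟨h0, hv, h14, hold, hnew⟩
      have hst : Stage m D lo hi w A s' :=
        h.congr (fun v hv' => hv v (by omega)) h0 fun i hi' => hold i (by omega)
      have hc := hst.candTerm_eval (r := 9) ((hv 9 (by norm_num)).trans h9) hp h14 ht
      have hidx : (Term.add (.mul (.var 8) (.var 2)) (.var 14)).eval s' = e * m + t := by
        simp [Term.eval, hv, h8, h.m_eq, h14]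
      have hle := cand_le R.list_le R.demand_le hp ht
      have run := Runs.store (K := K) 1 (.add (.mul (.var 8) (.var 2)) (.var 14)) (candTerm 9) s'
        (by omega)
      rw [hc, hidx] at run
      refine ⟨_, run, h14, ?_, fun v hv' => ?_, by simp, fun i hi' => ?_, fun j hj => ?_⟩
      · funext i
        simp [h0]
      · rw [State.setVar_var, if_neg (by omega), State.setArr_var, hv v hv']
      · rw [State.setVar_arr, State.setArr_arr, if_neg (by omega), hold i hi']
      · rw [State.setVar_arr, State.setArr_arr]
        by_cases hjt : j = t
        · simp [hjt]
        · rw [if_neg (by omega), hnew j (by omega)])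
    (t := 0) (s := s.setVar 14 0) (Nat.zero_le _)
    ⟨rfl, fun v hv => by rw [State.setVar_var, if_neg (by omega)], by simp, fun _ _ => rfl,
      fun j hj => absurd hj (Nat.not_lt_zero j)⟩
  refine ⟨s'.setVar 8 (e + 1), ((Runs.assign' (n := 0) rfl (by positivity)).seq (run.seq
    (Runs.assign' (n := e + 1) (by simp [Term.eval, e2, h8]) heK))).mono (by omega),
    e1, fun v hv => ?_, by simp, by simp [e2, h9], e4, e5⟩
  rw [State.setVar_var, if_neg (by omega), e2 v (by omega)]

/-- The list built for an agent from the candidates `lo * m, …, t - 1`. -/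
structure Collected (m D lo hi t : ℕ) (w A : ℕ → ℕ) (e : ℕ) (A' : ℕ → ℕ) : Prop where
  hi_le : hi ≤ e
  le_add : e ≤ hi + t
  old : ∀ i < hi * m, A' i = A i
  sound : ∀ r, hi ≤ r → r < e → ∃ p, lo * m ≤ p ∧ p < t ∧ Keep m D lo hi w A p ∧
    ∀ j < m, A' (r * m + j) = cand m w A p j
  complete : ∀ p, lo * m ≤ p → p < t → Keep m D lo hi w A p →
    ∃ r, hi ≤ r ∧ r < e ∧ ∀ j < m, A' (r * m + j) = cand m w A p j
  inj : ∀ r r', hi ≤ r → r < r' → r' < e → ∃ j < m, A' (r * m + j) ≠ A' (r' * m + j)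

lemma Collected.skip {t e : ℕ} {A' : ℕ → ℕ} (h : Collected m D lo hi t w A e A')
    (hk : ¬ Keep m D lo hi w A t) : Collected m D lo hi (t + 1) w A e A' where
  hi_le := h.hi_le
  le_add := h.le_add.trans (by omega)
  old := h.old
  sound r h1 h2 := by
    obtain ⟨p, a, b, c⟩ := h.sound r h1 h2
    exact ⟨p, a, by omega, c⟩
  complete p h1 h2 h3 := by
    refine h.complete p h1 (lt_of_le_of_ne (Nat.lt_succ_iff.mp h2) ?_) h3
    rintro rfl
    exact hk h3
  inj := h.inj

lemma Collected.append {t e : ℕ} {A' A'' : ℕ → ℕ} (h : Collected m D lo hi t w A e A')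
    (hlt : lo * m ≤ t) (ht : t < hi * m) (hk : Keep m D lo hi w A t)
    (hold : ∀ i < e * m, A'' i = A' i)
    (hnew : ∀ j < m, A'' (e * m + j) = cand m w A t j) :
    Collected m D lo hi (t + 1) w A (e + 1) A'' := by
  have hrow {r j : ℕ} (hr : r < e) (hj : j < m) : A'' (r * m + j) = A' (r * m + j) := by
    refine hold _ ?_
    calc r * m + j < (r + 1) * m := by rw [add_mul]; omega
      _ ≤ e * m := Nat.mul_le_mul_right _ hr
  refine ⟨h.hi_le.trans (by omega), by have := h.le_add; omega, fun i hi' => ?_, fun r h1 h2 => ?_,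
    fun p h1 h2 h3 => ?_, fun r r' h1 h2 h3 => ?_⟩
  · rw [hold i (hi'.trans_le (Nat.mul_le_mul_right _ h.hi_le)), h.old i hi']
  · rcases Nat.lt_succ_iff_lt_or_eq.mp h2 with h2 | rfl
    · obtain ⟨p, a, b, c, f⟩ := h.sound r h1 h2
      exact ⟨p, a, by omega, c, fun j hj => (hrow h2 hj).trans (f j hj)⟩
    · exact ⟨t, hlt, by omega, hk, hnew⟩
  · rcases Nat.lt_succ_iff_lt_or_eq.mp h2 with h2 | rfl
    · obtain ⟨r, a, b, f⟩ := h.complete p h1 h2 h3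
      exact ⟨r, a, by omega, fun j hj => (hrow b hj).trans (f j hj)⟩
    · exact ⟨e, h.hi_le, by omega, hnew⟩
  · rcases Nat.lt_succ_iff_lt_or_eq.mp h3 with h3 | rfl
    · obtain ⟨j, hj, hne⟩ := h.inj r r' h1 h2 h3
      exact ⟨j, hj, by rwa [hrow (h2.trans h3) hj, hrow h3 hj]⟩
    -- If the new row equalled an older one, the candidate behind the older row would come earlier
    -- and be equal to `t`, which the tie-break in `Keep` forbids.
    · by_contra! hcon
      obtain ⟨p, a, b, c, f⟩ := h.sound r h1 h2
      have heq (j : ℕ) (hj : j < m) : cand m w A p j = cand m w A t j := by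
        rw [← f j hj, ← hrow h2 hj, hcon j hj, hnew j hj]
      have := (hk.2 p a (by omega) fun j hj => (heq j hj).le).2
      omega

lemma runs_processAgent (R : Room K m D hi w A) (h : Stage m D lo hi w A s) (hlo : lo ≤ hi)
    (h8 : s.var 8 = hi) :
    ∃ e s', Runs K processAgent s s' (hi * m * (m * 6 + 12 + hi * m * (m * 6 + 9)) + 4) ∧
      s'.arr 0 = s.arr 0 ∧ (∀ v < 6, s'.var v = s.var v) ∧ s'.var 6 = hi ∧ s'.var 7 = e ∧
      s'.var 8 = e ∧ Collected m D lo hi (hi * m) w A e (s'.arr 1) := by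
  have lin := R.lin_lt
  have hmul : lo * m ≤ hi * m := Nat.mul_le_mul_right _ hlo
  have run1 : Runs K (.assign 9 (.mul (.var 6) (.var 2))) s (s.setVar 9 (lo * m)) 1 :=
    .assign' (by simp [Term.eval, h.lo_eq, h.m_eq]) (by omega)
  obtain ⟨s', run2, e0, e1, -, -, e2⟩ := Runs.upTo (K := K) (v := 9) (b := .mul (.var 7) (.var 2))
    (c := .seq testCandidate (.ite (.var 10) .skip appendCandidate)) (N := hi * m)
    (k := m * 6 + 10 + hi * m * (m * 6 + 9))
    (fun t s' => s'.arr 0 = s.arr 0 ∧ (∀ v < 8, s'.var v = s.var v) ∧ s'.var 9 = t ∧ lo * m ≤ t ∧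
      Collected m D lo hi t w A (s'.var 8) (s'.arr 1))
    (by omega)
    (by
      rintro t s' - ⟨-, hv, ht, -⟩
      exact ⟨by simp [Term.eval, hv, h.hi_eq, h.m_eq], ht⟩)
    (by
      rintro t s' ht ⟨h0, hv, h9, hlt, hcol⟩
      have hst : Stage m D lo hi w A s' :=
        h.congr hv h0 fun i hi' => (hcol.old i hi').trans (h.list_eq i hi').symm
      obtain ⟨s₁, r₁, f1, f2, f3⟩ := runs_testCandidate R hst hlo h9 ht
      have hst₁ : Stage m D lo hi w A s₁ :=
        hst.congr (fun v hv' => f2 v (by omega)) (by rw [f1]) fun _ _ => by rw [f1]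
      have hcol₁ : Collected m D lo hi t w A (s₁.var 8) (s₁.arr 1) := by
        rw [f1, f2 8 (by norm_num)]
        exact hcol
      by_cases hk : Keep m D lo hi w A t
      · have hle := hcol₁.le_add
        obtain ⟨s₂, r₂, g1, g2, g3, g4, g5, g6⟩ := runs_appendCandidate R hst₁
          ((f2 9 (by norm_num)).trans h9) ht rfl hcol₁.hi_le (by omega)
        refine ⟨s₂, (r₁.seq (Runs.iteFalse (x := .var 10) (f3.mpr hk) r₂)).mono (by omega), g4,
          ?_, fun v hv' => ?_, by simp, by omega, ?_⟩
        · rw [State.setVar_arr, g1, f1, h0]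
        · rw [State.setVar_var, if_neg (by omega), g2 v hv', f2 v (by omega), hv v hv']
        · simp only [State.setVar_var, State.setVar_arr]
          rw [if_neg (by norm_num), g3]
          exact hcol₁.append hlt ht hk g5 g6
      · refine ⟨s₁, (r₁.seq (Runs.iteTrue (x := .var 10) (fun hz => hk (f3.mp hz)) (Runs.skip _))).mono
          (by omega), (f2 9 (by norm_num)).trans h9, ?_, fun v hv' => ?_, by simp, by omega, ?_⟩
        · rw [State.setVar_arr, f1, h0]
        · rw [State.setVar_var, if_neg (by omega), f2 v (by omega), hv v hv']
        · simpa using hcol₁.skip hk)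
    (t := lo * m) (s := s.setVar 9 (lo * m)) hmul
    (by
      refine ⟨rfl, fun v hv => by rw [State.setVar_var, if_neg (by omega)], by simp, le_rfl, ?_⟩
      have : (s.setVar 9 (lo * m)).var 8 = hi := by simp [h8]
      rw [this]
      exact ⟨le_rfl, by omega, h.list_eq, fun r h1 h2 => by omega, fun p h1 h2 => by omega,
        fun r r' h1 h2 h3 => by omega⟩)
  have hle := e2.le_add
  refine ⟨s'.var 8, (s'.setVar 6 hi).setVar 7 (s'.var 8), (run1.seq (run2.seq
    ((Runs.assign' (by simp [Term.eval, e1, h.hi_eq]) (by omega)).seq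
      (Runs.assign' (by simp [Term.eval]) (by omega))))).mono ?_, e0, fun v hv => ?_, by simp,
      by simp, by simp, e2⟩
  · have := Nat.mul_le_mul_right (m * 6 + 10 + hi * m * (m * 6 + 9) + 2)
      (Nat.sub_le (hi * m) (lo * m))
    have e : m * 6 + 10 + hi * m * (m * 6 + 9) + 2 = m * 6 + 12 + hi * m * (m * 6 + 9) := by ring
    rw [e] at this ⊢
    omega
  · rw [State.setVar_var, if_neg (by omega), State.setVar_var, if_neg (by omega), e1 v (by omega)]

end

end BudgetDivision

/-! ## Correctness of the program -/

namespace BudgetDivision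

open RAM

section

variable {m D lo hi e k : ℕ} {d : ℕ → ℕ → ℕ} {w A A' : ℕ → ℕ}

/-- The vector number `r` of a list. -/
def vec (m : ℕ) (A : ℕ → ℕ) (r : ℕ) : Fin m → ℕ := fun j => A (r * m + j)

/-- The demands as vectors. -/
def demandVec (m : ℕ) (d : ℕ → ℕ → ℕ) (i : ℕ) : Fin m → ℕ := fun j => d i j

/-- The vectors from `lo` to `hi - 1` are the minimal solutions for the first `k` agents, without
repetition. -/
structure ListsMinimal (m D : ℕ) (d : ℕ → ℕ → ℕ) (k : ℕ) (A : ℕ → ℕ) (lo hi : ℕ) : Prop where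
  mem_iff : ∀ x, Minimal (Sol (demandVec m d) D k) x ↔ ∃ r, lo ≤ r ∧ r < hi ∧ vec m A r = x
  inj : ∀ r r', lo ≤ r → r < r' → r' < hi → vec m A r ≠ vec m A r'

lemma cand_eq_raise {r : ℕ} (l : Fin m) :
    (fun j : Fin m => cand m w A (r * m + l) j) = raise (vec m A r) (fun j => w j) l := by
  funext j
  have hm : 0 < m := l.pos
  have h1 : (r * m + l) / m = r := by
    rw [mul_comm, Nat.mul_add_div hm, Nat.div_eq_of_lt l.2, add_zero]
  have h2 : (r * m + l) % m = l := by
    rw [mul_comm, Nat.mul_add_mod, Nat.mod_eq_of_lt l.2]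
  simp [cand, raise, vec, h1, h2, Fin.ext_iff]

lemma exists_index {p : ℕ} (h1 : lo * m ≤ p) (h2 : p < hi * m) :
    ∃ (r : ℕ) (l : Fin m), lo ≤ r ∧ r < hi ∧ r * m + l = p := by
  have hm : 0 < m := Nat.pos_of_ne_zero (by rintro rfl; simp at h2)
  refine ⟨p / m, ⟨p % m, Nat.mod_lt _ hm⟩, (Nat.le_div_iff_mul_le hm).mpr h1,
    Nat.div_lt_of_lt_mul (by rwa [mul_comm]), ?_⟩
  rw [mul_comm]
  exact Nat.div_add_mod p m

lemma index_mem {r : ℕ} (l : Fin m) (h1 : lo ≤ r) (h2 : r < hi) :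
    lo * m ≤ r * m + l ∧ r * m + l < hi * m := by
  refine ⟨(Nat.mul_le_mul_right m h1).trans (Nat.le_add_right _ _), ?_⟩
  calc r * m + l < (r + 1) * m := by rw [add_mul]; omega
    _ ≤ hi * m := Nat.mul_le_mul_right _ h2

/-- Candidate `r * m + l` is vector `r` raised in all coordinates but `l`, so letting `q` range over
the candidates in `Keep` is letting `x` and `l` range over all pairs in `minimal_sol_succ_iff`. -/
lemma Keep.minimal (hL : ListsMinimal m D d k A lo hi) {p : ℕ} (h1 : lo * m ≤ p) (h2 : p < hi * m)
    (hK : Keep m D lo hi (d k) A p) :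
    Minimal (Sol (demandVec m d) D (k + 1)) fun j : Fin m => cand m (d k) A p j := by
  rw [minimal_sol_succ_iff]
  refine ⟨?_, ?_, ?_⟩
  · rw [← Finset.sum_range fun j => cand m (d k) A p j]
    exact hK.1
  · obtain ⟨r, l, hr, hr', rfl⟩ := exists_index h1 h2
    exact ⟨vec m A r, l, (hL.mem_iff _).mpr ⟨r, hr, hr', rfl⟩, (cand_eq_raise l).symm⟩
  · intro x l hx hle
    obtain ⟨r, hr, hr', rfl⟩ := (hL.mem_iff x).mp hx
    obtain ⟨i1, i2⟩ := index_mem l hr hr'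
    have heq : raise (vec m A r) (demandVec m d k) l =
      fun j : Fin m => cand m (d k) A (r * m + l) j := (cand_eq_raise l).symm
    rw [heq] at hle ⊢
    exact fun j => (hK.2 _ i1 i2 fun j hj => hle ⟨j, hj⟩).1 j j.2

/-- The same vector may arise from several candidates; the first of them survives the tie-break in
`Keep`, hence the use of `Nat.find`. -/
lemma exists_keep (hL : ListsMinimal m D d k A lo hi) {y : Fin m → ℕ}
    (hy : Minimal (Sol (demandVec m d) D (k + 1)) y) :
    ∃ p, lo * m ≤ p ∧ p < hi * m ∧ Keep m D lo hi (d k) A p ∧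
      y = fun j : Fin m => cand m (d k) A p j := by
  obtain ⟨hs, ⟨x, l, hx, hxy⟩, hmin⟩ := minimal_sol_succ_iff.mp hy
  obtain ⟨r, hr, hr', rfl⟩ := (hL.mem_iff x).mp hx
  have hex : ∃ p, (lo * m ≤ p ∧ p < hi * m) ∧ y = fun j : Fin m => cand m (d k) A p j :=
    ⟨r * m + l, index_mem l hr hr', hxy.symm.trans (cand_eq_raise l).symm⟩
  classical
  obtain ⟨⟨h1, h2⟩, h3⟩ := Nat.find_spec hex
  refine ⟨Nat.find hex, h1, h2, ⟨?_, fun q q1 q2 hq => ?_⟩, h3⟩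
  · rw [Finset.sum_range fun j => cand m (d k) A (Nat.find hex) j]
    exact (congrArg (fun z : Fin m → ℕ => ∑ j, z j) h3).symm.trans_le hs
  · have hle : (fun j : Fin m => cand m (d k) A q j) ≤ y := by
      rw [h3]
      exact fun j => hq j j.2
    have hge : y ≤ fun j : Fin m => cand m (d k) A q j := by
      obtain ⟨r, l, hr, hr', rfl⟩ := exists_index q1 q2
      have heq : (fun j : Fin m => cand m (d k) A (r * m + l) j) =
        raise (vec m A r) (demandVec m d k) l := cand_eq_raise l
      rw [heq] at hle ⊢
      exact hmin _ l ((hL.mem_iff _).mpr ⟨r, hr, hr', rfl⟩) hle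
    refine ⟨fun j hj => ?_, Nat.find_min' hex ⟨⟨q1, q2⟩, le_antisymm hge hle⟩⟩
    have := hge ⟨j, hj⟩
    rwa [h3] at this

lemma ListsMinimal.step (hL : ListsMinimal m D d k A lo hi)
    (hC : Collected m D lo hi (hi * m) (d k) A e A') : ListsMinimal m D d (k + 1) A' hi e := by
  constructor
  · intro x
    constructor
    · intro hx
      obtain ⟨p, h1, h2, hK, rfl⟩ := exists_keep hL hx
      obtain ⟨r, a, b, c⟩ := hC.complete p h1 h2 hK
      exact ⟨r, a, b, funext fun j => c j j.2⟩
    · rintro ⟨r, a, b, rfl⟩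
      obtain ⟨p, h1, h2, hK, c⟩ := hC.sound r a b
      have : vec m A' r = fun j : Fin m => cand m (d k) A p j := funext fun j => c j j.2
      rw [this]
      exact hK.minimal hL h1 h2
  · intro r r' h1 h2 h3 heq
    obtain ⟨j, hj, hne⟩ := hC.inj r r' h1 h2 h3
    exact hne (congrFun heq ⟨j, hj⟩)

/-- A kept candidate has coordinate sum at most `D`, so each of its entries is at most `D`. This
keeps the stored numbers from growing from one agent to the next. -/
lemma Collected.list_le (hC : Collected m D lo hi (hi * m) w A e A')
    (hA : ∀ i < hi * m, A i ≤ D) : ∀ i < e * m, A' i ≤ D := by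
  intro i hi'
  by_cases hlt : i < hi * m
  · rw [hC.old i hlt]
    exact hA i hlt
  obtain ⟨r, l, hr, hr', rfl⟩ := exists_index (not_lt.mp hlt) hi'
  obtain ⟨p, -, -, hK, hc⟩ := hC.sound r hr hr'
  rw [hc l l.2]
  exact (Finset.single_le_sum (f := fun j => cand m w A p j) (fun _ _ => Nat.zero_le _)
    (Finset.mem_range.mpr l.2)).trans hK.1

/-- The untouched array already represents the list for no agents, which consists of the zero vector
alone. -/
lemma listsMinimal_zero (hA : ∀ i, A i = 0) : ListsMinimal m D d 0 A 0 1 := by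
  have h0 (r : ℕ) : vec m A r = 0 := funext fun j => hA _
  constructor
  · intro x
    rw [minimal_sol_zero_iff]
    exact ⟨fun h => ⟨0, le_rfl, one_pos, by rw [h, h0]⟩, fun ⟨r, _, _, h⟩ => by rw [← h, h0]⟩
  · intro r r' _ h1 h2
    omega

/-- A bound for the number of minimal solutions. -/
def listBound (n m : ℕ) : ℕ := (2 * (m * (n + 1)) + 1) ^ 4

/-- Without repetitions, the length of the list is the number of minimal solutions, to which
`card_minimal_le` applies. -/
lemma ListsMinimal.length_le (hL : ListsMinimal m D d k A lo hi)
    (hd : ∀ i < k, ∑ j, demandVec m d i j = D) {n : ℕ} (hk : k ≤ n) :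
    hi - lo ≤ listBound n m := by
  classical
  have hinj : Set.InjOn (vec m A) (Finset.Ico lo hi) := by
    intro r hr r' hr' heq
    simp only [Finset.coe_Ico, Set.mem_Ico] at hr hr'
    by_contra hne
    rcases Nat.lt_or_gt_of_ne hne with h | h
    · exact hL.inj r r' hr.1 h hr'.2 heq
    · exact hL.inj r' r hr'.1 h hr.2 heq.symm
  have hcard := Finset.card_image_of_injOn hinj
  rw [Nat.card_Ico] at hcard
  rw [← hcard]
  refine (card_minimal_le hd _ fun x hx => ?_).trans ?_
  · obtain ⟨r, hr, rfl⟩ := Finset.mem_image.mp hx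
    rw [Finset.mem_Ico] at hr
    exact (hL.mem_iff _).mpr ⟨r, hr.1, hr.2, rfl⟩
  · unfold listBound
    gcongr

end

/-- A bound for the number of vectors that are stored. -/
def storeBound (n m : ℕ) : ℕ := 1 + n * listBound n m

/-- A bound for the number of steps of the program. -/
def stepBound (n m : ℕ) : ℕ :=
  n * m * 3 + n * (storeBound n m * m * (m * 6 + 12 + storeBound n m * m * (m * 6 + 9)) + 6) + 8

theorem runs_decideProgram {K n m D : ℕ} {d : ℕ → ℕ → ℕ} {s : State} (hs : ∀ v, v ≠ 0 → s.var v = 0)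
    (h1 : ∀ i, s.arr 1 i = 0) (hn : s.arr 0 0 = n) (hm : s.arr 0 1 = m)
    (hpos : ∀ t < n * m, 0 < s.arr 0 (3 + 2 * t))
    (hD : D = ∏ t ∈ Finset.range (n * m), s.arr 0 (3 + 2 * t))
    (hd : ∀ i < n, ∀ j < m,
      s.arr 0 (2 + 2 * (i * m + j)) * (D / s.arr 0 (3 + 2 * (i * m + j))) = d i j)
    (hsum : ∀ i < n, ∑ j, demandVec m d i j = D)
    (hnK : n < 2 ^ K) (hnmK : n * m < 2 ^ K)
    (hK : (m * D + storeBound n m * m + storeBound n m + m + D + 1) ^ 2 +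
      (m * D + storeBound n m * m + storeBound n m + m + D + 1) < 2 ^ K) :
    ∃ s', Runs K decideProgram s s' (stepBound n m) ∧
      ((∃ x, Sol (demandVec m d) D n x) → s'.var 0 = 1) ∧
      ((¬ ∃ x, Sol (demandVec m d) D n x) → s'.var 0 = 0) := by
  have hlin : m * D + storeBound n m * m + storeBound n m + m + D + 1 < 2 ^ K :=
    (Nat.le_add_left _ _).trans_lt hK
  have run1 : Runs K (.assign 1 (.arr 0 (.lit 0))) s (s.setVar 1 n) 1 :=
    .assign' (by simp [Term.eval, hn]) hnK
  have run2 : Runs K (.assign 2 (.arr 0 (.lit 1))) (s.setVar 1 n) ((s.setVar 1 n).setVar 2 m) 1 :=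
    .assign' (by simp [Term.eval, hm]) (by omega)
  set s₂ := (s.setVar 1 n).setVar 2 m with hs₂
  have run3 : Runs K (.assign 3 (.lit 1)) s₂ (s₂.setVar 3 1) 1 :=
    .assign' (by simp [Term.eval]) (by omega)
  obtain ⟨s₄, run4, rfl⟩ := Runs.upTo (K := K) (v := 4) (b := .mul (.var 1) (.var 2))
    (c := .assign 3 (.mul (.var 3) (.arr 0 (.add (.lit 3) (.mul (.lit 2) (.var 4))))))
    (N := n * m) (k := 1)
    (fun t s' => s' = (s₂.setVar 3 (∏ t ∈ Finset.range t, s.arr 0 (3 + 2 * t))).setVar 4 t) hnmK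
    (by
      rintro t s' - rfl
      simp [Term.eval, hs₂])
    (by
      rintro t s' ht rfl
      have hle : ∏ t ∈ Finset.range (t + 1), s.arr 0 (3 + 2 * t) ≤ D := by
        rw [hD]
        exact Finset.prod_le_prod_of_subset_of_one_le' (Finset.range_mono ht)
          fun i hi _ => hpos i (Finset.mem_range.mp hi)
      refine ⟨_, .assign' (n := ∏ t ∈ Finset.range (t + 1), s.arr 0 (3 + 2 * t)) ?_ (by omega),
        ?_, ?_⟩
      · simp [Term.eval, hs₂, Finset.prod_range_succ]
      · simp
      · rw [State.setVar_comm _ (v := 3) (w := 4) (by norm_num), State.setVar_setVar,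
          State.setVar_comm _ (v := 4) (w := 3) (by norm_num), State.setVar_setVar])
    (t := 0) (s := s₂.setVar 3 1) (Nat.zero_le _)
    (by
      -- The program does not initialise the counter; register `4` is still `0` from the initial
      -- state.
      have : (s₂.setVar 3 1).var 4 = 0 := by simp [hs₂, hs 4]
      simp only [Finset.range_zero, Finset.prod_empty]
      conv_rhs => rw [← this]
      simp [State.setVar])
  rw [← hD] at run4
  set s₄ := (s₂.setVar 3 D).setVar 4 (n * m) with hs₄
  have run5 : Runs K (.assign 7 (.lit 1)) s₄ (s₄.setVar 7 1) 1 :=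
    .assign' (by simp [Term.eval]) (by omega)
  have run6 : Runs K (.assign 8 (.lit 1)) (s₄.setVar 7 1) ((s₄.setVar 7 1).setVar 8 1) 1 :=
    .assign' (by simp [Term.eval]) (by omega)
  set s₆ := (s₄.setVar 7 1).setVar 8 1 with hs₆
  have hstore {k : ℕ} (hk : k ≤ n) : 1 + k * listBound n m ≤ storeBound n m :=
    Nat.add_le_add_left (Nat.mul_le_mul_right _ hk) 1
  obtain ⟨s₇, run7, -, -, -, -, -, lo, hi, h6, h7, -, hlo, hhi, hL, -⟩ :=
    Runs.upTo (K := K) (v := 5) (b := .var 1) (c := processAgent) (N := n)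
    (k := storeBound n m * m * (m * 6 + 12 + storeBound n m * m * (m * 6 + 9)) + 4)
    (fun k s' => s'.arr 0 = s.arr 0 ∧ s'.var 1 = n ∧ s'.var 2 = m ∧ s'.var 3 = D ∧ s'.var 5 = k ∧
      ∃ lo hi, s'.var 6 = lo ∧ s'.var 7 = hi ∧ s'.var 8 = hi ∧ lo ≤ hi ∧
        hi ≤ 1 + k * listBound n m ∧ ListsMinimal m D d k (s'.arr 1) lo hi ∧
        ∀ i < hi * m, s'.arr 1 i ≤ D) hnK
    (by
      rintro t s' - ⟨-, hv1, -, -, hv5, -⟩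
      exact ⟨by simpa [Term.eval] using hv1, hv5⟩)
    (by
      rintro k s' hk ⟨h0, hv1, hv2, hv3, hv5, lo, hi, hv6, hv7, hv8, hlo, hhi, hL, hA⟩
      have hhi' : hi ≤ storeBound n m := hhi.trans (hstore hk.le)
      have hst : Stage m D lo hi (d k) (s'.arr 1) s' := by
        refine ⟨hv2, hv3, hv6, hv7, fun j hj => ?_, fun _ _ => rfl⟩
        rw [← hd k hk j hj]
        simp [demandTerm, Term.eval, hv2, hv3, hv5, h0]
      have R : Room K m D hi (d k) (s'.arr 1) := by
        refine ⟨hA, fun j hj => ?_, lt_of_le_of_lt ?_ hK⟩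
        · rw [← hsum k hk]
          exact Finset.single_le_sum (f := demandVec m d k) (fun _ _ => Nat.zero_le _)
            (Finset.mem_univ ⟨j, hj⟩)
        · gcongr
      obtain ⟨e, s'', run, g0, gv, g6, g7, g8, hC⟩ := runs_processAgent R hst hlo hv8
      have hL' := hL.step hC
      -- Old lists are never discarded, so each agent adds at most `listBound n m` vectors to the
      -- store.
      have hlen := hL'.length_le (fun i hi => hsum i (by omega)) (n := n) hk
      have hhe := hC.hi_le
      refine ⟨s'', run.mono (by gcongr), (gv 5 (by norm_num)).trans hv5, ?_, ?_, ?_, ?_, by simp,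
        hi, e, ?_, ?_, ?_, hhe, ?_, hL', hC.list_le hA⟩
      · rw [State.setVar_arr, g0, h0]
      · simpa [gv] using hv1
      · simpa [gv] using hv2
      · simpa [gv] using hv3
      · simpa using g6
      · simpa using g7
      · simpa using g8
      · rw [add_mul, one_mul]
        omega)
    (t := 0) (s := s₆) (Nat.zero_le _)
    (by
      refine ⟨rfl, by simp [hs₆, hs₄, hs₂], by simp [hs₆, hs₄, hs₂], by simp [hs₆, hs₄],
        by simp [hs₆, hs₄, hs₂, hs 5], 0, 1, by simp [hs₆, hs₄, hs₂, hs 6], by simp [hs₆],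
        by simp [hs₆], zero_le_one, by simp, listsMinimal_zero h1, fun i _ => ?_⟩
      exact (h1 i).trans_le (Nat.zero_le _))
  -- This is `1` if the last list is nonempty and `0` otherwise; a solution exists exactly when a
  -- minimal one does.
  have hans : (Term.sub (.lit 1) (.sub (.lit 1) (.sub (.var 7) (.var 6)))).eval s₇ =
      1 - (1 - (hi - lo)) := by
    simp [Term.eval, h6, h7]
  refine ⟨s₇.setVar 0 (1 - (1 - (hi - lo))), (run1.seq (run2.seq (run3.seq (run4.seq (run5.seq
    (run6.seq (run7.seq (.assign' hans (by omega)))))))) ).mono ?_, ?_, ?_⟩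
  · unfold stepBound
    rw [Nat.sub_zero, Nat.sub_zero]
    apply le_of_eq
    ring
  · rintro ⟨x, hx⟩
    obtain ⟨y, -, hy⟩ := exists_minimal_le hx
    obtain ⟨r, hr, hr', -⟩ := (hL.mem_iff y).mp hy
    simp only [State.setVar_var, if_true]
    omega
  · intro hno
    have : hi ≤ lo := by
      by_contra hlt
      exact hno ⟨_, ((hL.mem_iff _).mpr ⟨lo, le_rfl, not_le.mp hlt, rfl⟩).1⟩
    simp only [State.setVar_var, if_true]
    omega

end BudgetDivision

/-! ## The encoded instance -/

namespace BudgetDivision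

open RAM

lemma length_flatMap_finRange {n c : ℕ} (f : Fin n → List ℕ) (hf : ∀ i, (f i).length = c) :
    ((List.finRange n).flatMap f).length = n * c := by
  simp [List.length_flatMap, hf]

lemma getD_flatMap_finRange {n c : ℕ} (f : Fin n → List ℕ) (hf : ∀ i, (f i).length = c)
    (i : Fin n) {j : ℕ} (hj : j < c) :
    ((List.finRange n).flatMap f).getD (i * c + j) 0 = (f i).getD j 0 := by
  induction n with
  | zero => exact i.elim0
  | succ n ih =>
    rw [List.finRange_succ, List.flatMap_cons, List.flatMap_map]
    refine Fin.cases ?_ (fun i => ?_) i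
    · rw [List.getD_append _ _ _ _ (by simpa [hf] using hj)]
      simp
    · have hidx : (i.succ : ℕ) * c + j = c + (i * c + j) := by
        rw [Fin.val_succ, add_mul]
        ring
      rw [List.getD_append_right _ _ _ _ (by rw [hf, hidx]; omega), hf, hidx,
        Nat.add_sub_cancel_left]
      exact ih (fun i => f i.succ) (fun i => hf _) i

/-- The block of the encoding that describes agent `i`. -/
def Instance.row (I : Instance) (i : Fin I.n) : List ℕ :=
  (List.finRange I.m).flatMap fun j => [(I.demand i j).num.toNat, (I.demand i j).den]

lemma Instance.length_row (I : Instance) (i : Fin I.n) : (I.row i).length = I.m * 2 :=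
  length_flatMap_finRange _ fun _ => rfl

lemma Instance.length_encode (I : Instance) : I.encode.length = I.n * (I.m * 2) + 2 := by
  have := length_flatMap_finRange I.row I.length_row
  simp only [Instance.encode, List.length_cons]
  exact congrArg (· + 2) this

lemma Instance.getD_encode (I : Instance) (i : Fin I.n) (j : Fin I.m) {b : ℕ} (hb : b < 2) :
    I.encode.getD (b + 2 + 2 * (i * I.m + j)) 0 =
      [(I.demand i j).num.toNat, (I.demand i j).den].getD b 0 := by
  have hidx : b + 2 + 2 * (i * I.m + j) = i * (I.m * 2) + (j * 2 + b) + 1 + 1 := by ring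
  rw [hidx, Instance.encode, List.getD_cons_succ, List.getD_cons_succ]
  rw [show ((List.finRange I.n).flatMap fun i => (List.finRange I.m).flatMap fun j =>
    [(I.demand i j).num.toNat, (I.demand i j).den]) = (List.finRange I.n).flatMap I.row from rfl,
    getD_flatMap_finRange I.row I.length_row i (by have := j.2; omega), Instance.row,
    getD_flatMap_finRange (c := 2) _ (fun _ => rfl) j hb]

lemma Instance.getD_encode_num (I : Instance) (i : Fin I.n) (j : Fin I.m) :
    I.encode.getD (2 + 2 * (i * I.m + j)) 0 = (I.demand i j).num.toNat :=
  I.getD_encode i j (b := 0) (by norm_num)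

lemma Instance.getD_encode_den (I : Instance) (i : Fin I.n) (j : Fin I.m) :
    I.encode.getD (3 + 2 * (i * I.m + j)) 0 = (I.demand i j).den :=
  I.getD_encode i j (b := 1) (by norm_num)

lemma getD_le_maxNumber (l : List ℕ) (i : ℕ) : l.getD i 0 ≤ maxNumber l := by
  induction l generalizing i with
  | nil => simp
  | cons a l ih =>
    cases i with
    | zero => simp [maxNumber]
    | succ i =>
      rw [List.getD_cons_succ]
      exact (ih i).trans (le_max_right _ _)

lemma length_le_inputLength (l : List ℕ) : l.length ≤ inputLength l := by
  induction l with
  | nil => simp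
  | cons a l ih =>
    simp only [inputLength, List.length_cons, List.map_cons, List.sum_cons] at ih ⊢
    omega

/-- The product of all denominators. -/
def Instance.scale (I : Instance) : ℕ :=
  ∏ t ∈ Finset.range (I.n * I.m), I.encode.getD (3 + 2 * t) 0

/-- The demands, multiplied by the product of all denominators. -/
def Instance.scaledDemand (I : Instance) (i j : ℕ) : ℕ :=
  I.encode.getD (2 + 2 * (i * I.m + j)) 0 * (I.scale / I.encode.getD (3 + 2 * (i * I.m + j)) 0)

lemma Instance.den_pos (I : Instance) {t : ℕ} (ht : t < I.n * I.m) :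
    0 < I.encode.getD (3 + 2 * t) 0 := by
  obtain ⟨r, l, -, hr, rfl⟩ := exists_index (lo := 0) (by simp) ht
  have := I.getD_encode_den ⟨r, hr⟩ l
  simp only at this
  rw [this]
  exact Rat.den_pos _

lemma Instance.scale_pos (I : Instance) : 0 < I.scale :=
  Finset.prod_pos fun _ ht => I.den_pos (Finset.mem_range.mp ht)

lemma Instance.scaledDemand_eq (I : Instance) (i : Fin I.n) (j : Fin I.m) :
    (I.scaledDemand i j : ℚ) = I.demand i j * I.scale := by
  have hdvd : (I.demand i j).den ∣ I.scale := by
    rw [← I.getD_encode_den i j]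
    exact Finset.dvd_prod_of_mem (fun t => I.encode.getD (3 + 2 * t) 0)
      (Finset.mem_range.mpr (index_mem (lo := 0) j (Nat.zero_le _) i.2).2)
  have hnum : (((I.demand i j).num.toNat : ℕ) : ℚ) = (I.demand i j).num := by
    have := Int.toNat_of_nonneg (Rat.num_nonneg.mpr (I.demand_mem i j).1)
    exact_mod_cast this
  have hden : ((I.demand i j).den : ℚ) ≠ 0 := by exact_mod_cast (I.demand i j).den_ne_zero
  unfold Instance.scaledDemand
  rw [I.getD_encode_num, I.getD_encode_den, Nat.cast_mul, hnum, Nat.cast_div hdvd hden]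
  conv_rhs => rw [← Rat.num_div_den (I.demand i j)]
  ring

lemma Instance.sum_scaledDemand (I : Instance) (hI : I.Tight) {i : ℕ} (hi : i < I.n) :
    ∑ j, demandVec I.m I.scaledDemand i j = I.scale := by
  have h := hI ⟨i, hi⟩
  have : ((∑ j, demandVec I.m I.scaledDemand i j : ℕ) : ℚ) = I.scale := by
    rw [Nat.cast_sum, ← one_mul (I.scale : ℚ), ← h, Finset.sum_mul]
    exact Finset.sum_congr rfl fun j _ => I.scaledDemand_eq ⟨i, hi⟩ j
  exact_mod_cast this

/-! ### Reduction to the integral problem. -/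

/-- At most one coordinate fails. Positivity of `m` is needed because for `m = 0` the left side
holds by truncation, while there is no coordinate to exempt. -/
lemma pred_le_ncard_iff {m : ℕ} (hm : 0 < m) (P : Fin m → Prop) :
    m - 1 ≤ Set.ncard {j | P j} ↔ ∃ l, ∀ j, j ≠ l → P j := by
  have hadd := Set.ncard_add_ncard_compl {j | P j}
  rw [Nat.card_fin] at hadd
  constructor
  · intro h
    have h1 : ({j | P j}ᶜ : Set (Fin m)).ncard ≤ 1 := by omega
    rw [Set.ncard_le_one_iff_subsingleton] at h1
    by_cases hne : ({j | P j}ᶜ : Set (Fin m)).Nonempty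
    · obtain ⟨l, hl⟩ := hne
      refine ⟨l, fun j hj => ?_⟩
      by_contra hP
      exact hj (h1 hP hl)
    · rw [Set.not_nonempty_iff_eq_empty, Set.compl_empty_iff] at hne
      exact ⟨⟨0, hm⟩, fun j _ => by simpa using hne.ge (Set.mem_univ j)⟩
  · rintro ⟨l, hl⟩
    have hsub : ({j | P j}ᶜ : Set (Fin m)) ⊆ {l} := by
      intro j hj
      by_contra hne
      exact hj (hl j hne)
    have := Set.ncard_le_ncard hsub
    rw [Set.ncard_singleton] at this
    omega

/-- The problem is equivalent to the integral problem with scaled demands. -/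
lemma Instance.allAgentsSat_iff (I : Instance) (hI : I.Tight) : I.AllAgentsSat (I.m - 1) ↔
    ∃ x, Sol (demandVec I.m I.scaledDemand) I.scale I.n x := by
  have hD : (0 : ℝ) < I.scale := by exact_mod_cast I.scale_pos
  -- Tightness of a single agent excludes `m = 0`, since an empty sum is not `1`.
  have hm (i : Fin I.n) : 0 < I.m := by
    refine Nat.pos_of_ne_zero fun h => ?_
    have := hI i
    rw [Finset.sum_eq_zero fun j _ => absurd j.2 (by omega)] at this
    exact zero_ne_one this
  have hd (i : Fin I.n) (j : Fin I.m) : (I.scaledDemand i j : ℝ) = I.demand i j * I.scale := by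
    exact_mod_cast congrArg (fun q : ℚ => (q : ℝ)) (I.scaledDemand_eq i j)
  constructor
  · rintro ⟨x, ⟨hx, hs⟩, hsat⟩
    -- Rounding down keeps the budget, and keeps every inequality with a scaled demand because that
    -- demand is an integer.
    refine ⟨fun j => ⌊x j * I.scale⌋₊, ?_, fun i hi => ?_⟩
    · have : ((∑ j, ⌊x j * I.scale⌋₊ : ℕ) : ℝ) ≤ I.scale := by
        rw [Nat.cast_sum]
        calc ∑ j, (⌊x j * I.scale⌋₊ : ℝ) ≤ ∑ j, x j * I.scale :=
              Finset.sum_le_sum fun j _ => Nat.floor_le (mul_nonneg (hx j).1 hD.le)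
          _ = (∑ j, x j) * I.scale := by rw [Finset.sum_mul]
          _ ≤ 1 * I.scale := by gcongr
          _ = I.scale := one_mul _
      exact_mod_cast this
    · obtain ⟨l, hl⟩ := (pred_le_ncard_iff (hm ⟨i, hi⟩) _).mp (hsat ⟨i, hi⟩)
      refine ⟨l, fun j hj => Nat.le_floor ?_⟩
      have := hd ⟨i, hi⟩ j
      simp only at this
      simp only [demandVec]
      rw [this]
      exact mul_le_mul_of_nonneg_right (hl j hj) hD.le
  · rintro ⟨x, hs, hcov⟩
    have hs' : ∑ j, (x j : ℝ) ≤ I.scale := by exact_mod_cast hs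
    refine ⟨fun j => x j / I.scale, ⟨fun j => ⟨by positivity, ?_⟩, ?_⟩, fun i => ?_⟩
    · rw [div_le_one hD]
      exact (Finset.single_le_sum (f := fun j => (x j : ℝ)) (fun _ _ => Nat.cast_nonneg _)
        (Finset.mem_univ j)).trans hs'
    · rw [← Finset.sum_div, div_le_one hD]
      exact hs'
    · obtain ⟨l, hl⟩ := hcov i i.2
      refine (pred_le_ncard_iff (hm i) _).mpr ⟨l, fun j hj => ?_⟩
      rw [le_div_iff₀ hD, ← hd i j]
      exact_mod_cast hl j hj

/-! ### Polynomial bounds in the input size. -/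

/-- A bound for the bit length of the numbers that occur in the computation. -/
def bitBound (X : ℕ) : ℕ := 2 * (X + storeBound X X + (X * X + 1)) + 2

lemma storeBound_mono {n m X : ℕ} (hn : n ≤ X) (hm : m ≤ X) :
    storeBound n m ≤ storeBound X X := by
  unfold storeBound listBound
  gcongr

lemma stepBound_mono {n m X : ℕ} (hn : n ≤ X) (hm : m ≤ X) : stepBound n m ≤ stepBound X X := by
  have := storeBound_mono hn hm
  unfold stepBound
  gcongr

lemma lt_two_pow_bitBound {n m D X : ℕ} (hn : n ≤ X) (hm : m ≤ X) (hD : D ≤ 2 ^ (X * X)) :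
    (m * D + storeBound n m * m + storeBound n m + m + D + 1) ^ 2 +
      (m * D + storeBound n m * m + storeBound n m + m + D + 1) < 2 ^ bitBound X := by
  have h1 : m + 1 ≤ 2 ^ X := Nat.lt_two_pow_self.trans_le' (by omega)
  have h2 : storeBound n m + 1 ≤ 2 ^ storeBound X X :=
    Nat.lt_two_pow_self.trans_le' (by have := storeBound_mono hn hm; omega)
  have h3 : D + 1 ≤ 2 ^ (X * X + 1) := by
    have := Nat.one_le_two_pow (n := X * X)
    rw [pow_succ]
    omega
  set H := storeBound n m
  set Q := m * D + H * m + H + m + D + 1 with hQ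
  have hprod : Q ≤ (m + 1) * (H + 1) * (D + 1) := by
    rw [hQ]
    nlinarith [Nat.zero_le (m * H * D), Nat.zero_le (H * D)]
  have hpow : Q ≤ 2 ^ (X + storeBound X X + (X * X + 1)) := by
    rw [pow_add, pow_add]
    exact hprod.trans (Nat.mul_le_mul (Nat.mul_le_mul h1 h2) h3)
  -- The factor `2` in `bitBound` pays for the square of `Q`, and the summand `2` gives the factor
  -- `4`, more than enough for `Q ^ 2 + Q`.
  have hbit : 2 ^ bitBound X = 4 * (2 ^ (X + storeBound X X + (X * X + 1))) ^ 2 := by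
    unfold bitBound
    ring
  rw [hbit]
  have hQ1 : 1 ≤ Q := by omega
  nlinarith

lemma Instance.scale_le (I : Instance) {X : ℕ} (hX : maxNumber I.encode ≤ X)
    (hnm : I.n * I.m ≤ X) : I.scale ≤ 2 ^ (X * X) := by
  calc I.scale ≤ ∏ _t ∈ Finset.range (I.n * I.m), 2 ^ X :=
        Finset.prod_le_prod' fun t _ =>
          ((getD_le_maxNumber _ _).trans hX).trans Nat.lt_two_pow_self.le
    _ = 2 ^ (X * (I.n * I.m)) := by rw [Finset.prod_const, Finset.card_range, ← pow_mul]
    _ ≤ 2 ^ (X * X) := Nat.pow_le_pow_right (by norm_num) (Nat.mul_le_mul_left _ hnm)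

theorem Instance.decidesWithin (I : Instance) (hI : I.Tight) {X : ℕ}
    (hX : X = inputLength I.encode + maxNumber I.encode) :
    DecidesWithin decideProgram I.encode
      (stepBound X X * (decideProgram.weight * (bitBound X + 1))) (I.AllAgentsSat (I.m - 1)) := by
  have hmax : maxNumber I.encode ≤ X := by omega
  have hlen : I.encode.length ≤ X := by have := length_le_inputLength I.encode; omega
  have hn : I.n ≤ X := (getD_le_maxNumber I.encode 0).trans hmax
  have hm : I.m ≤ X := (getD_le_maxNumber I.encode 1).trans hmax
  -- Each of the `n * m` demands occupies two entries of the input, whereas `n` and `m` are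
  -- themselves entries.
  have hnm : I.n * I.m ≤ X := by
    have h := I.length_encode
    rw [← mul_assoc] at h
    omega
  have hXK : X < 2 ^ bitBound X :=
    Nat.lt_two_pow_self.trans_le (Nat.pow_le_pow_right (by norm_num) (by unfold bitBound; omega))
  have hbound : (initialState I.encode).Bounded (bitBound X) := by
    refine ⟨fun v => ?_, fun a i => ?_⟩
    · simp only [initialState]
      split_ifs <;> omega
    · simp only [initialState]
      have := getD_le_maxNumber I.encode i
      split_ifs <;> omega
  obtain ⟨s, hrun, hyes, hno⟩ := runs_decideProgram (K := bitBound X) (n := I.n) (m := I.m)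
    (D := I.scale) (d := I.scaledDemand) (s := initialState I.encode)
    (fun v hv => by simp [initialState, hv]) (fun i => by simp [initialState]) rfl rfl
    (fun t ht => I.den_pos ht) rfl (fun i _ j _ => rfl) (fun i hi => I.sum_scaledDemand hI hi)
    (by omega) (by omega) (lt_two_pow_bitBound hn hm (I.scale_le hmax hnm))
  obtain ⟨-, t, hexec, ht⟩ := (hrun.mono (stepBound_mono hn hm)).exec hbound
  rw [I.allAgentsSat_iff hI]
  exact ⟨s, t, hexec, ht, hyes, hno⟩

end BudgetDivision

theorem theorem5 :
    RAM.PseudoPolyTimeDecidable BudgetDivision.Instance.encode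
      (fun I => I.Tight) (fun I => I.AllAgentsSat (I.m - 1)) := by
  let Z : Polynomial ℕ := Polynomial.X
  -- `H`, `T` and `L` are `storeBound X X`, `stepBound X X` and `bitBound X` written as polynomials
  -- in `X`.
  let H : Polynomial ℕ := 1 + Z * (2 * (Z * (Z + 1)) + 1) ^ 4
  let T : Polynomial ℕ := Z * Z * 3 + Z * (H * Z * (Z * 6 + 12 + H * Z * (Z * 6 + 9)) + 6) + 8
  let L : Polynomial ℕ := 2 * (Z + H + (Z * Z + 1)) + 2
  refine ⟨BudgetDivision.decideProgram,
    T * (Polynomial.C BudgetDivision.decideProgram.weight * (L + 1)), fun I hI => ?_⟩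
  convert I.decidesWithin hI rfl using 1
  simp [T, L, H, Z, BudgetDivision.stepBound, BudgetDivision.bitBound, BudgetDivision.storeBound,
    BudgetDivision.listBound]
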